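/- Let $k\ge 0$, $m\ge 0$ be integers, $n=2^m$, and let $G$ be a graph whose vertex set is partitioned into $k$ blocks $V_1,\dots,V_k$ of size $n$, the vertices of each block being identified with the strings in $\{0,1\}^m$. For a set $U$ of vertices let $B(U)\subseteq[k]$ be the set of blocks meeting $U$, and let $N^\cap(U,i)$ be the set of vertices of $V_i$ adjacent to all vertices of $U$. Let $\alpha,\beta$ be reals with $0<\alpha\le 1$ and $0<\beta<1/300$, and let $R$ be a positive integer with $100\,(1-\alpha)R\le 1$. Assume that $G$ has $(\alpha,\beta,R)$-bounded common neighborhoods: for every set $U$ of at most $R$ vertices and every $i\in[k]\setminus B(U)$, $$(1-\beta)\alpha^{|U|}n\le |N^\cap(U,i)|\le(1+\beta)\alpha^{|U|}n .$$ For a set $M$ of vertices in which any two vertices from distinct blocks are adjacent, $\mathrm{NonEdge}_M$ is the following search problem. The input is an assignment $x$ to the variables $x_{i,j}\in\mathbb F_2$, $i\in[k]\setminus B(M)$, $j\in[m]$ (so $x$ selects the vertex $(x_{i,1},\dots,x_{i,m})$ in each block $V_i$ with $i\notin B(M)$) such that the vertex selected in each such block $V_i$ lies in $N^\cap(M,i)$.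 A correct output is a pair of distinct selected vertices not joined by an edge. An affine-DAG is a finite rooted directed acyclic graph, all of whose nodes are reachable from the root, in which every node $v$ is labeled by an affine subspace $F_v$ (the solution set of a linear system, possibly empty) of the space of all assignments over $\mathbb F_2$ to the variables; the root is labeled by the whole space; and every non-leaf $v$ has a linear form $P_v$ and two outgoing edges labeled $P_v=0$ and $P_v=1$, such that the endpoint $w$ of the edge $P_v=b$ satisfies $\{x\in F_v: P_v(x)=b\}\subseteq F_w$. It solves $\mathrm{NonEdge}_M$ if for each leaf $\ell$ there is a single pair of distinct vertices of $G$ that is a correct output for every input of $\mathrm{NonEdge}_M$ that lies in $F_\ell$. Its size is the number of nodes, and its depth is the length (number of edges) of a longest root-to-leaf path. **Lemma.** There is a universal constant $C>0$ such that the following holds for all $k,m,\alpha,\beta,R,G,M$ as above. Suppose there is an affine-DAG solving $\mathrm{NonEdge}_M$ of depth at most $D$ and size at most $S$, for integers $D\geq 0$ and $S\geq 1$. Then $$D>\frac{R-|M|}{8}.$$ Moreover, let $d=\big\lfloor\sqrt{\log_2 S}\cdot\min(\sqrt R,\,1/\beta)\big\rfloor$. If $|M|+8d\le R$, then $d\le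 D$, and there are a set of vertices $M^*\supseteq M$ with $|M^*|\le|M|+C\log_2 S$, in which any two vertices from distinct blocks are adjacent, and an affine-DAG solving $\mathrm{NonEdge}_{M^*}$ of depth at most $D-d$ and size at most $S$. -/

import Mathlib

/-! ### Blocked graphs and common neighborhoods -/

namespace BinClique

/-- The vertex set of a graph over `k` blocks of size `n = 2 ^ m`: the vertex `(i, y)` is the vertex
of block `i` whose binary representation is `y ∈ {0,1}^m`. -/
abbrev Vertex (k m : ℕ) : Type := Fin k × (Fin m → ZMod 2)

/-- `B(U)`, the set of blocks that contain a vertex of `U`. -/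
def blocks {k m : ℕ} (U : Finset (Vertex k m)) : Finset (Fin k) :=
  U.image Prod.fst

/-- `N^∩(U, i)`, the common neighborhood of `U` in block `i`. -/
def commonNbhd {k m : ℕ} (G : SimpleGraph (Vertex k m)) (U : Finset (Vertex k m)) (i : Fin k) :
    Set (Vertex k m) :=
  {v | v.1 = i ∧ ∀ u ∈ U, G.Adj u v}

/-- `G` has `(α, β, R)`-bounded common neighborhoods. -/
def HasBoundedCommonNbhds {k m : ℕ} (G : SimpleGraph (Vertex k m)) (α β : ℝ) (R : ℕ) : Prop :=
  ∀ U : Finset (Vertex k m), U.card ≤ R → ∀ i : Fin k, i ∉ blocks U →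
    (1 - β) * α ^ U.card * (2 : ℝ) ^ m ≤ ((commonNbhd G U i).ncard : ℝ) ∧
      ((commonNbhd G U i).ncard : ℝ) ≤ (1 + β) * α ^ U.card * (2 : ℝ) ^ m

/-- Any two vertices of `M` that lie in distinct blocks are joined by an edge. -/
def CrossAdjacent {k m : ℕ} (G : SimpleGraph (Vertex k m)) (M : Finset (Vertex k m)) : Prop :=
  ∀ u ∈ M, ∀ v ∈ M, u.1 ≠ v.1 → G.Adj u v

/-! ### Affine-DAGs -/

/-- Inputs: assignments of values in `𝔽₂` to the variables in `ι`. -/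
abbrev Assignment (ι : Type) : Type := ι → ZMod 2

/-- Linear forms over `𝔽₂` in the variables `ι`. -/
abbrev LinForm (ι : Type) : Type := Assignment ι →ₗ[ZMod 2] ZMod 2

/-- The edge relation of a DAG in which a node is either a leaf (`none`) or is labeled by a form `P`
and has, for each `b ∈ 𝔽₂`, an outgoing edge labeled `P = b`. -/
def IsChild {N F : Type} (step : N → Option (F × (ZMod 2 → N))) (v w : N) : Prop :=
  ∃ (P : F) (c : ZMod 2 → N) (b : ZMod 2), step v = some (P, c) ∧ c b = w

/-- An affine-DAG over the variables `ι`: a finite rooted directed acyclic graph whose nodes are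
labeled by affine subspaces of `𝔽₂^ι` (solution sets of linear systems, possibly inconsistent ones).
The root is labeled by the whole space; a non-leaf `v` has two outgoing edges labeled `P_v = 0` and
`P_v = 1`, and the label of the endpoint of the edge `P_v = b` is implied by the label of `v`
together with `P_v = b`. -/
structure AffineDAG (ι : Type) where
  /-- the nodes -/
  Node : Type
  finite : Finite Node
  /-- the root -/
  root : Node
  /-- the affine subspace labeling a node -/
  label : Node → AffineSubspace (ZMod 2) (Assignment ι)
  /-- `none` at a leaf, else the queried linear form and the endpoints of the two edges -/
  step : Node → Option (LinForm ι × (ZMod 2 → Node))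
  acyclic : ∀ v, ¬ Relation.TransGen (IsChild step) v v
  reachable : ∀ v, Relation.ReflTransGen (IsChild step) root v
  label_root : label root = ⊤
  label_child : ∀ (v : Node) (P : LinForm ι) (c : ZMod 2 → Node), step v = some (P, c) →
    ∀ b : ZMod 2, ∀ x ∈ label v, P x = b → x ∈ label (c b)

/-- There is a directed path with `l` edges from the first node to the second. -/
inductive HasPath {N : Type} (E : N → N → Prop) : N → N → ℕ → Prop
  | nil (v : N) : HasPath E v v 0
  | cons {u v w : N} {l : ℕ} : E u v → HasPath E v w l → HasPath E u w (l + 1)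

namespace AffineDAG

/-- A node without outgoing edges. -/
def IsLeaf {ι : Type} (A : AffineDAG ι) (v : A.Node) : Prop :=
  A.step v = none

/-- The size: the number of nodes. -/
noncomputable def size {ι : Type} (A : AffineDAG ι) : ℕ :=
  Nat.card A.Node

/-- The depth (the length of a longest root-to-leaf path) is at most `D`. -/
def DepthAtMost {ι : Type} (A : AffineDAG ι) (D : ℕ) : Prop :=
  ∀ (v : A.Node) (l : ℕ), A.IsLeaf v → HasPath (IsChild A.step) A.root v l → l ≤ D

/-- `A` solves the search problem with set of inputs `I` and relation `S`: for every leaf there is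
an output that is correct on all inputs in the affine subspace labeling the leaf. -/
def Solves {ι O : Type} (A : AffineDAG ι) (I : Set (Assignment ι)) (S : Assignment ι → O → Prop) :
    Prop :=
  ∀ v : A.Node, A.IsLeaf v → ∃ o : O, ∀ x ∈ I, x ∈ A.label v → S x o

end AffineDAG

/-! ### The search problem `NonEdge_M` -/

/-- The blocks outside of `B(M)`. -/
abbrev FreeBlock {k m : ℕ} (M : Finset (Vertex k m)) : Type := {i : Fin k // i ∉ blocks M}

/-- The variables `x_{i,j}` with `i ∉ B(M)`. -/
abbrev FreeVar {k m : ℕ} (M : Finset (Vertex k m)) : Type := FreeBlock M × Fin m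

/-- The vertex of block `i` that is selected by the assignment `x`. -/
def selected {k m : ℕ} {M : Finset (Vertex k m)} (x : Assignment (FreeVar M)) (i : FreeBlock M) :
    Vertex k m :=
  (i.1, fun j => x (i, j))

/-- The inputs of `NonEdge_M`: every selected vertex lies in the common neighborhood of `M`. -/
def nonEdgeInputs {k m : ℕ} (G : SimpleGraph (Vertex k m)) (M : Finset (Vertex k m)) :
    Set (Assignment (FreeVar M)) :=
  {x | ∀ i : FreeBlock M, selected x i ∈ commonNbhd G M i.1}

/-- The outputs of `NonEdge_M`: unordered pairs of distinct vertices. -/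
abbrev VertexPair (k m : ℕ) : Type := {e : Sym2 (Vertex k m) // ¬ e.IsDiag}

/-- The relation of `NonEdge_M`: `e` consists of two selected vertices not connected by an edge. -/
def nonEdgeRel {k m : ℕ} (G : SimpleGraph (Vertex k m)) (M : Finset (Vertex k m))
    (x : Assignment (FreeVar M)) (e : VertexPair k m) : Prop :=
  ∃ i j : FreeBlock M, e.1 = s(selected x i, selected x j) ∧ ¬ G.Adj (selected x i) (selected x j)

/-- The affine-DAG `A` solves `NonEdge_M` for the graph `G`. -/
def SolvesNonEdge {k m : ℕ} (G : SimpleGraph (Vertex k m)) (M : Finset (Vertex k m))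
    (A : AffineDAG (FreeVar M)) : Prop :=
  A.Solves (nonEdgeInputs G M) (nonEdgeRel G M)

end BinClique

/-! The argument follows a random walk in the affine-DAG while maintaining a restriction: an affine
map `x ↦ A x + b` whose image lies in the label of the current node and which commits some blocks to
vertices of a cross-adjacent set `W ⊇ M`. If the pulled-back query is constant, its answer is
forced. Otherwise it involves a variable `(i, j)` of an uncommitted block. A random string `z` is
drawn among those for which both `z` and `z + e_j` give common neighbors of `W`; block `i` is set to
`z` except for bit `j`, which is solved for so that the query answers `z j`. Both candidate vertices
join `W`, so a step costs at most two vertices. A restriction with `|W| ≤ R` cannot reach a leaf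
(`IsRestriction.not_isLeaf`), which gives the depth bound.

The size bound rests on a potential argument (`exists_walk`). To end at a node labeled `F`, the
image of every intermediate restriction must meet `F`. If a substitution lowers the rank modulo `F`
by `s`, at most a `2^{-s}` fraction of all strings keeps such an intersection. Since at least
`24/25` of the strings are allowed, each unit of rank costs a factor `3/4`, and a node is hit with
probability at most `(3/4)^codim F`. Some node has probability at least `1/S`, hence codimension `c
≤ 3 log₂ S`.

The walk's own restriction commits too many blocks, so it is replaced
(`IsRestriction.exists_small`). A Rado-type theorem supplies blocks `T` and variables `C` in
distinct other blocks, with `|T| + |C| ≤ c`, such that the columns of `C` span all columns outside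
`T`. Fixing `T` and reserving two vertices for each variable in `C` lets `C` solve the equations of
`F` for all other inputs. This adds at most `2c` vertices, and the sub-DAG below the node, pulled
back along the new map, solves the restricted problem. -/

namespace BinClique

/-! ### Rank and kernel counting over `𝔽₂`. -/

section LinearAlgebra

variable {E V X : Type*} [AddCommGroup E] [AddCommGroup V] [AddCommGroup X]
  [Module (ZMod 2) E] [Module (ZMod 2) V] [Module (ZMod 2) X]

/-- A set all of whose differences lie in the kernel of `θ` is at most as large as the kernel. -/
theorem card_mul_two_pow_finrank_range_le [Fintype E] (θ : E →ₗ[ZMod 2] X) (H : Finset E)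
    (hH : ∀ z ∈ H, ∀ z' ∈ H, θ (z - z') = 0) :
    H.card * 2 ^ Module.finrank (ZMod 2) (LinearMap.range θ) ≤ Fintype.card E := by
  classical
  rcases H.eq_empty_or_nonempty with rfl | ⟨z₀, hz₀⟩
  · simp
  have hker : H.card ≤ Fintype.card (LinearMap.ker θ) := by
    rw [← Fintype.card_coe]
    refine Fintype.card_le_of_injective
      (fun z => (⟨z.1 - z₀, hH z.1 z.2 z₀ hz₀⟩ : LinearMap.ker θ)) ?_
    intro a b hab
    have := congrArg Subtype.val hab
    simp only [sub_left_inj] at this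
    exact Subtype.ext this
  have h1 := Module.card_eq_pow_finrank (K := ZMod 2) (V := LinearMap.ker θ)
  have h2 := Module.card_eq_pow_finrank (K := ZMod 2) (V := E)
  rw [ZMod.card] at h1 h2
  rw [h1] at hker
  rw [h2, ← θ.finrank_range_add_finrank_ker, pow_add, mul_comm]
  exact Nat.mul_le_mul_left _ hker

/-- Since `σ` and `s` jointly cover `V`, the rank lost by passing from `Λ` to `Λ ∘ σ` must be
supplied by `s` modulo the range of `Λ ∘ σ`. -/
theorem finrank_range_le_add [FiniteDimensional (ZMod 2) V] [FiniteDimensional (ZMod 2) E]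
    (Λ : V →ₗ[ZMod 2] X) (σ : V →ₗ[ZMod 2] V)
    (s : E →ₗ[ZMod 2] V) (h : ∀ v, ∃ x z, v = σ x + s z) :
    Module.finrank (ZMod 2) (LinearMap.range Λ) ≤
      Module.finrank (ZMod 2) (LinearMap.range (Λ ∘ₗ σ)) +
      Module.finrank (ZMod 2)
        (LinearMap.range ((LinearMap.range (Λ ∘ₗ σ)).mkQ ∘ₗ Λ ∘ₗ s)) := by
  set Y := LinearMap.range (Λ ∘ₗ σ)
  have hsub : LinearMap.range Λ ≤ Y ⊔ LinearMap.range (Λ ∘ₗ s) := by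
    rintro _ ⟨v, rfl⟩
    obtain ⟨x, z, rfl⟩ := h v
    rw [map_add]
    exact Submodule.add_mem_sup ⟨x, rfl⟩ ⟨z, rfl⟩
  set ψ := Y.mkQ.domRestrict (LinearMap.range Λ)
  have h1 := ψ.finrank_range_add_finrank_ker
  have h2 : Module.finrank (ZMod 2) (LinearMap.ker ψ) ≤ Module.finrank (ZMod 2) Y := by
    have hmem : ∀ x : LinearMap.ker ψ, (x.1 : X) ∈ Y := fun x => by
      have hx : Y.mkQ (x.1 : X) = 0 := x.2
      exact (Submodule.Quotient.mk_eq_zero Y).1 hx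
    refine LinearMap.finrank_le_finrank_of_injective
      (f := LinearMap.codRestrict Y
        ((LinearMap.range Λ).subtype ∘ₗ (LinearMap.ker ψ).subtype) hmem) ?_
    intro a b hab
    have := congrArg Subtype.val hab
    exact Subtype.ext (Subtype.ext this)
  have h3 : LinearMap.range ψ ≤ LinearMap.range (Y.mkQ ∘ₗ Λ ∘ₗ s) := by
    rintro _ ⟨⟨_, v, rfl⟩, rfl⟩
    obtain ⟨x, z, rfl⟩ := h v
    refine ⟨z, ?_⟩
    have : Y.mkQ (Λ (σ x)) = 0 := by
      rw [Submodule.mkQ_apply, Submodule.Quotient.mk_eq_zero]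
      exact ⟨x, rfl⟩
    simp only [LinearMap.comp_apply, ψ, LinearMap.domRestrict_apply, map_add, this, zero_add]
  have h4 := Submodule.finrank_mono h3
  omega

/-- A linear section of `g` over its range, extended to the whole space. -/
theorem exists_section_on_range (g : E →ₗ[ZMod 2] X) :
    ∃ h : X →ₗ[ZMod 2] E, ∀ w ∈ LinearMap.range g, g (h w) = w := by
  obtain ⟨h₀, hh₀⟩ := g.rangeRestrict.exists_rightInverse_of_surjective g.range_rangeRestrict
  obtain ⟨h, hh⟩ := LinearMap.exists_extend h₀
  refine ⟨h, fun w hw => ?_⟩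
  have h1 : h w = h₀ ⟨w, hw⟩ := LinearMap.congr_fun hh ⟨w, hw⟩
  rw [h1]
  have h2 := LinearMap.congr_fun hh₀ ⟨w, hw⟩
  exact congrArg Subtype.val h2

end LinearAlgebra

/-! ### Rado-type transversals of blocks of vectors. -/

section Transversal

variable {β γ X : Type*}
  [AddCommGroup X] [Module (ZMod 2) X] [FiniteDimensional (ZMod 2) X]

/-- The rank of the vectors `col p`, `p ∈ C`. -/
noncomputable def colRank (col : β × γ → X) (C : Finset (β × γ)) : ℕ :=
  Module.finrank (ZMod 2) (Submodule.span (ZMod 2) (col '' C))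

theorem colRank_mono (col : β × γ → X) {C D : Finset (β × γ)} (h : C ⊆ D) :
    colRank col C ≤ colRank col D :=
  Submodule.finrank_mono (Submodule.span_mono (Set.image_mono (by exact_mod_cast h)))

theorem colRank_submodular [DecidableEq β] [DecidableEq γ] (col : β × γ → X) (C D : Finset (β × γ)) :
    colRank col (C ∪ D) + colRank col (C ∩ D) ≤ colRank col C + colRank col D := by
  have h := Submodule.finrank_sup_add_finrank_inf_eq
    (Submodule.span (ZMod 2) (col '' C)) (Submodule.span (ZMod 2) (col '' D))
  rw [← Submodule.span_union, ← Set.image_union] at h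
  have h2 : Submodule.span (ZMod 2) (col '' ((C ∩ D : Finset (β × γ)) : Set (β × γ))) ≤
      Submodule.span (ZMod 2) (col '' C) ⊓ Submodule.span (ZMod 2) (col '' D) := by
    refine le_inf ?_ ?_ <;> refine Submodule.span_mono (Set.image_mono ?_) <;> simp
  have h3 := Submodule.finrank_mono h2
  unfold colRank
  rw [Finset.coe_union]
  omega

/-- Rado's theorem with a deficiency: if `rank C_B + |B₀ \ B| ≥ c` for all `B ⊆ B₀`, then there is
a subset of `C` of rank at least `c` that has at most one element in each block. -/
theorem exists_transversal_of_le [DecidableEq β] (col : β × γ → X) (B₀ : Finset β) (c : ℕ)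
    (C₀ : Finset (β × γ))
    (h₀ : ∀ B ⊆ B₀, c ≤ colRank col (C₀.filter (·.1 ∈ B)) + (B₀ \ B).card) :
    ∃ C ⊆ C₀.filter (·.1 ∈ B₀), Set.InjOn Prod.fst (C : Set (β × γ)) ∧ c ≤ colRank col C := by
  classical
  let good : Finset (β × γ) → Prop := fun C =>
    ∀ B ⊆ B₀, c ≤ colRank col (C.filter (·.1 ∈ B)) + (B₀ \ B).card
  obtain ⟨C, hC, hmin⟩ := exists_minimal_le_of_wellFoundedLT good C₀ h₀
  refine ⟨C.filter (·.1 ∈ B₀), Finset.filter_subset_filter _ hC, ?_, ?_⟩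
  · rintro x hx y hy hxy
    by_contra hne
    simp only [Finset.coe_filter, Set.mem_ofPred_eq] at hx hy
    have key : ∀ z ∈ C, ∃ B ⊆ B₀, colRank col ((C.erase z).filter (·.1 ∈ B)) + (B₀ \ B).card < c := by
      intro z hz
      by_contra hcon
      push Not at hcon
      have := hmin.2 (y := C.erase z) hcon (Finset.erase_subset _ _) hz
      simp at this
    obtain ⟨B₁, hB₁, h1⟩ := key x hx.1
    obtain ⟨B₂, hB₂, h2⟩ := key y hy.1
    have mem_of : ∀ z B, colRank col ((C.erase z).filter (·.1 ∈ B)) + (B₀ \ B).card < c → B ⊆ B₀ →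
        z.1 ∈ B := by
      intro z B h hB
      by_contra hz
      have hg := hmin.1 B hB
      have : (C.erase z).filter (·.1 ∈ B) = C.filter (·.1 ∈ B) := by
        ext p
        simp only [Finset.mem_filter, Finset.mem_erase]
        constructor
        · rintro ⟨⟨_, h⟩, h'⟩; exact ⟨h, h'⟩
        · rintro ⟨h, h'⟩; exact ⟨⟨fun e => hz (e ▸ h'), h⟩, h'⟩
      rw [this] at h
      omega
    have hx1 := mem_of x B₁ h1 hB₁
    have hy2 := mem_of y B₂ h2 hB₂
    have hs := colRank_submodular col ((C.erase x).filter (·.1 ∈ B₁))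
      ((C.erase y).filter (·.1 ∈ B₂))
    have hu : C.filter (·.1 ∈ B₁ ∪ B₂) ⊆
        (C.erase x).filter (·.1 ∈ B₁) ∪ (C.erase y).filter (·.1 ∈ B₂) := by
      intro p
      simp only [Finset.mem_filter, Finset.mem_union, Finset.mem_erase]
      rintro ⟨hp, hpB⟩
      by_cases hpx : p = x
      · subst hpx
        exact Or.inr ⟨⟨hne, hp⟩, hxy ▸ hy2⟩
      by_cases hpy : p = y
      · subst hpy
        exact Or.inl ⟨⟨hpx, hp⟩, hxy ▸ hx1⟩
      · rcases hpB with h | h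
        · exact Or.inl ⟨⟨hpx, hp⟩, h⟩
        · exact Or.inr ⟨⟨hpy, hp⟩, h⟩
    have hi : C.filter (·.1 ∈ (B₁ ∩ B₂).erase x.1) ⊆
        (C.erase x).filter (·.1 ∈ B₁) ∩ (C.erase y).filter (·.1 ∈ B₂) := by
      intro p
      simp only [Finset.mem_filter, Finset.mem_inter, Finset.mem_erase]
      rintro ⟨hp, hpx, hp1, hp2⟩
      exact ⟨⟨⟨fun e => hpx (e ▸ rfl), hp⟩, hp1⟩, ⟨⟨fun e => hpx (e ▸ hxy.symm), hp⟩, hp2⟩⟩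
    -- The two failing inequalities sum to at most `2c - 2`. By submodularity this sum dominates the
    -- `good` bounds for `B₁ ∪ B₂` and for `B₁ ∩ B₂` without the shared block, up to 1 for the
    -- erased block, so it is at least `2c - 1`.
    have g1 := hmin.1 (B₁ ∪ B₂) (Finset.union_subset hB₁ hB₂)
    have g2 := hmin.1 ((B₁ ∩ B₂).erase x.1)
      ((Finset.erase_subset _ _).trans (Finset.inter_subset_left.trans hB₁))
    have m1 := colRank_mono col hu
    have m2 := colRank_mono col hi
    have c1 := Finset.card_sdiff_add_card_eq_card hB₁
    have c2 := Finset.card_sdiff_add_card_eq_card hB₂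
    have c3 := Finset.card_sdiff_add_card_eq_card (Finset.union_subset hB₁ hB₂)
    have c4 := Finset.card_sdiff_add_card_eq_card
      ((Finset.erase_subset x.1 (B₁ ∩ B₂)).trans (Finset.inter_subset_left.trans hB₁))
    have hxi : x.1 ∈ B₁ ∩ B₂ := Finset.mem_inter.2 ⟨hx1, hxy ▸ hy2⟩
    have c5 := Finset.card_erase_add_one hxi
    have c6 := Finset.card_union_add_card_inter B₁ B₂
    omega
  · have := hmin.1 B₀ subset_rfl
    simpa using this

/-- There are a set `T` of blocks and a partial transversal `C` of the other blocks such that the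
vectors of `C` span all vectors of the other blocks, and `|T| + |C|` is at most the dimension. -/
theorem exists_blocks_and_transversal [Fintype β] [Fintype γ] (col : β × γ → X) :
    ∃ (T : Finset β) (C : Finset (β × γ)), Set.InjOn Prod.fst (C : Set (β × γ)) ∧
      (∀ p ∈ C, p.1 ∉ T) ∧ (∀ p, p.1 ∉ T → col p ∈ Submodule.span (ZMod 2) (col '' C)) ∧
      T.card + C.card ≤ Module.finrank (ZMod 2) X := by
  classical
  obtain ⟨B₀, -, hB₀⟩ := Finset.exists_min_image (Finset.univ : Finset (Finset β))
    (fun B => colRank col (Finset.univ.filter (·.1 ∈ B)) + Bᶜ.card) Finset.univ_nonempty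
  obtain ⟨C, hC, hinj, hrank⟩ := exists_transversal_of_le col B₀
    (colRank col (Finset.univ.filter (·.1 ∈ B₀))) Finset.univ (by
      intro B hB
      have h1 := hB₀ B (Finset.mem_univ _)
      have c1 := Finset.card_sdiff_add_card_eq_card hB
      have c2 := Finset.card_add_card_compl B
      have c3 := Finset.card_add_card_compl B₀
      omega)
  -- Thinning `C` to a basis of its span makes its cardinality equal to the rank.
  obtain ⟨κ, a, ha, hspan, hli⟩ := exists_linearIndependent' (K := ZMod 2)
    (fun p : C => col p.1)
  have hfin : Finite κ := Finite.of_injective a ha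
  let C' : Finset (β × γ) := (Set.range fun t => (a t).1).toFinite.toFinset
  have hC'mem : ∀ p, p ∈ C' ↔ ∃ t, (a t).1 = p := fun p => by simp [C']
  have hC'C : C' ⊆ C := fun p hp => by
    obtain ⟨t, rfl⟩ := (hC'mem p).1 hp
    exact (a t).2
  have himg : col '' (C' : Set (β × γ)) = Set.range ((fun p : C => col p.1) ∘ a) := by
    ext w
    simp [C']
  have himg2 : Set.range (fun p : C => col p.1) = col '' (C : Set (β × γ)) := by
    ext w
    simp
  have hspan' : Submodule.span (ZMod 2) (col '' (C' : Set (β × γ))) =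
      Submodule.span (ZMod 2) (col '' ((Finset.univ.filter (·.1 ∈ B₀) : Finset (β × γ)) :
        Set (β × γ))) := by
    rw [himg, hspan, himg2]
    exact Submodule.eq_of_le_of_finrank_le
      (Submodule.span_mono (Set.image_mono (by exact_mod_cast hC))) hrank
  have hcard : C'.card = colRank col (Finset.univ.filter (·.1 ∈ B₀)) := by
    have : Fintype κ := Fintype.ofFinite κ
    unfold colRank
    rw [← hspan', himg, finrank_span_eq_card hli, ← Finset.card_univ,
      ← Finset.card_image_of_injective Finset.univ
        (Subtype.val_injective.comp ha : Function.Injective fun t => (a t).1)]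
    congr 1
    ext p
    simp [C']
  refine ⟨B₀ᶜ, C', hinj.mono (by exact_mod_cast hC'C), ?_, ?_, ?_⟩
  · intro p hp
    have := hC (hC'C hp)
    simpa using this
  · intro p hp
    rw [hspan']
    exact Submodule.subset_span ⟨p, by simpa using hp, rfl⟩
  -- Now `|T| + |C|` is the minimum value; comparison with the set of all blocks bounds it by the
  -- total rank.
  · have h1 := hB₀ Finset.univ (Finset.mem_univ _)
    have h2 : colRank col (Finset.univ.filter (·.1 ∈ (Finset.univ : Finset β))) ≤
        Module.finrank (ZMod 2) X := Submodule.finrank_le _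
    simp only [Finset.compl_univ, Finset.card_empty, add_zero] at h1
    omega

end Transversal

end BinClique

namespace BinClique

/-! ### Common neighbors and greedy extension of cross-adjacent sets. -/

section Graph

variable {k m R : ℕ} {α β : ℝ} {G : SimpleGraph (Vertex k m)}

/-- Bernoulli's inequality gives `α ^ R ≥ 1 - R (1 - α) ≥ 99/100`, and the factor `1 - β > 299/300`
still leaves more than `49/50`. -/
theorem one_sub_mul_le_ncard_commonNbhd (hα0 : 0 < α) (hα1 : α ≤ 1) (hβ : β < 1 / 300)
    (hR : 100 * (1 - α) * (R : ℝ) ≤ 1) (hG : HasBoundedCommonNbhds G α β R)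
    {W : Finset (Vertex k m)} (hW : W.card ≤ R) {i : Fin k} (hi : i ∉ blocks W) :
    49 / 50 * (2 : ℝ) ^ m ≤ ((commonNbhd G W i).ncard : ℝ) := by
  refine le_trans ?_ (hG W hW i hi).1
  refine mul_le_mul_of_nonneg_right ?_ (by positivity)
  have h1 : α ^ R ≤ α ^ W.card := pow_le_pow_of_le_one hα0.le hα1 hW
  have h2 : 1 + (R : ℝ) * (α - 1) ≤ α ^ R := by
    have := one_add_mul_le_pow (a := α - 1) (by linarith) R
    simpa using this
  have h3 : 99 / 100 ≤ α ^ W.card := by nlinarith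
  nlinarith

/-- The strings `y` such that `(i, y)` is a common neighbor of `W`. -/
noncomputable def goodStrings (G : SimpleGraph (Vertex k m)) (W : Finset (Vertex k m))
    (i : Fin k) : Finset (Fin m → ZMod 2) :=
  (Set.toFinite {y | (i, y) ∈ commonNbhd G W i}).toFinset

theorem mem_goodStrings {W : Finset (Vertex k m)} {i : Fin k} {y : Fin m → ZMod 2} :
    y ∈ goodStrings G W i ↔ ∀ u ∈ W, G.Adj u (i, y) := by
  simp [goodStrings, commonNbhd]

theorem card_goodStrings (W : Finset (Vertex k m)) (i : Fin k) :
    (goodStrings G W i).card = (commonNbhd G W i).ncard := by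
  have h : commonNbhd G W i = (fun y => (i, y)) '' (goodStrings G W i : Set (Fin m → ZMod 2)) := by
    ext ⟨a, y⟩
    simp only [Set.mem_image, Finset.mem_coe, mem_goodStrings, commonNbhd, Prod.mk.injEq]
    constructor
    · rintro ⟨rfl, h⟩
      exact ⟨y, h, rfl, rfl⟩
    · rintro ⟨z, h, rfl, rfl⟩
      exact ⟨rfl, h⟩
  rw [h, Set.ncard_image_of_injective _ (fun a b hab => (Prod.mk.inj hab).2),
    Set.ncard_coe_finset]

/-- Every vertex set of size at most `R` has at least `0.98 n` common neighbors in each block that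
it does not meet. -/
def ManyCommonNbrs (G : SimpleGraph (Vertex k m)) (R : ℕ) : Prop :=
  ∀ W : Finset (Vertex k m), W.card ≤ R → ∀ i ∉ blocks W,
    49 * 2 ^ m ≤ 50 * (goodStrings G W i).card

theorem manyCommonNbrs (hα0 : 0 < α) (hα1 : α ≤ 1) (hβ : β < 1 / 300)
    (hR : 100 * (1 - α) * (R : ℝ) ≤ 1) (hG : HasBoundedCommonNbhds G α β R) :
    ManyCommonNbrs G R := by
  intro W hW i hi
  have h := one_sub_mul_le_ncard_commonNbhd hα0 hα1 hβ hR hG hW hi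
  rw [← card_goodStrings] at h
  have : (49 : ℝ) * 2 ^ m ≤ 50 * (goodStrings G W i).card := by linarith
  exact_mod_cast this

/-- The strings `y` such that `(i, y)` and `(i, y + e)` are common neighbors of `W`. -/
noncomputable def goodPairs (G : SimpleGraph (Vertex k m)) (W : Finset (Vertex k m))
    (i : Fin k) (e : Fin m → ZMod 2) : Finset (Fin m → ZMod 2) :=
  (goodStrings G W i).filter fun y => y + e ∈ goodStrings G W i

/-- The good strings and their translate by `e` each miss at most `1/50` of the block, so their
intersection misses at most `1/25`. -/
theorem ManyCommonNbrs.card_goodPairs (hG : ManyCommonNbrs G R)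
    {W : Finset (Vertex k m)} (hW : W.card ≤ R) {i : Fin k} (hi : i ∉ blocks W)
    (e : Fin m → ZMod 2) : 24 * 2 ^ m ≤ 25 * (goodPairs G W i e).card := by
  classical
  have h := hG W hW i hi
  have h2 : ((goodStrings G W i).image (· + e)).card = (goodStrings G W i).card :=
    Finset.card_image_of_injective _ (add_left_injective e)
  have h3 : (goodStrings G W i) ∩ ((goodStrings G W i).image (· + e)) ⊆ goodPairs G W i e := by
    intro y hy
    obtain ⟨hy1, hy2⟩ := Finset.mem_inter.1 hy
    obtain ⟨z, hz, rfl⟩ := Finset.mem_image.1 hy2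
    refine Finset.mem_filter.2 ⟨hy1, ?_⟩
    have : z + e + e = z := by
      ext l
      simp [add_assoc, CharTwo.add_self_eq_zero]
    rwa [this]
  have h4 := Finset.card_le_card h3
  have h5 := Finset.card_union_add_card_inter (goodStrings G W i)
    ((goodStrings G W i).image (· + e))
  have h6 : ((goodStrings G W i) ∪ ((goodStrings G W i).image (· + e))).card ≤ 2 ^ m := by
    refine (Finset.card_le_univ _).trans ?_
    simp [ZMod.card]
  omega

theorem ManyCommonNbrs.goodPairs_nonempty (hG : ManyCommonNbrs G R)
    {W : Finset (Vertex k m)} (hW : W.card ≤ R) {i : Fin k} (hi : i ∉ blocks W)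
    (e : Fin m → ZMod 2) : (goodPairs G W i e).Nonempty := by
  rw [← Finset.card_pos]
  have := hG.card_goodPairs hW hi e
  have : 0 < 2 ^ m := by positivity
  omega

theorem mem_blocks {W : Finset (Vertex k m)} {i : Fin k} : i ∈ blocks W ↔ ∃ v ∈ W, v.1 = i := by
  simp [blocks]

theorem fst_mem_blocks {W : Finset (Vertex k m)} {v : Vertex k m} (hv : v ∈ W) :
    v.1 ∈ blocks W :=
  mem_blocks.2 ⟨v, hv, rfl⟩

/-- `W` together with `(i, y)` and `(i, y + e)`. -/
noncomputable def addPair (W : Finset (Vertex k m)) (i : Fin k) (y e : Fin m → ZMod 2) :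
    Finset (Vertex k m) :=
  insert (i, y) (insert (i, y + e) W)

theorem subset_addPair {W : Finset (Vertex k m)} {i : Fin k} {y e : Fin m → ZMod 2} :
    W ⊆ addPair W i y e :=
  fun _ hv => Finset.mem_insert_of_mem (Finset.mem_insert_of_mem hv)

theorem mem_addPair {W : Finset (Vertex k m)} {i : Fin k} {y e : Fin m → ZMod 2} {v : Vertex k m} :
    v ∈ addPair W i y e ↔ v = (i, y) ∨ v = (i, y + e) ∨ v ∈ W := by
  simp [addPair]

theorem mem_blocks_addPair {W : Finset (Vertex k m)} {i : Fin k} {y e : Fin m → ZMod 2}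
    {j : Fin k} : j ∈ blocks (addPair W i y e) ↔ j = i ∨ j ∈ blocks W := by
  simp only [blocks, addPair, Finset.image_insert, Finset.mem_insert]
  tauto

theorem card_addPair_le (W : Finset (Vertex k m)) (i : Fin k) (y e : Fin m → ZMod 2) :
    (addPair W i y e).card ≤ W.card + 2 :=
  (Finset.card_insert_le _ _).trans (Nat.add_le_add_right (Finset.card_insert_le _ _) 1)

theorem card_addPair_zero_le (W : Finset (Vertex k m)) (i : Fin k) (y : Fin m → ZMod 2) :
    (addPair W i y 0).card ≤ W.card + 1 := by
  simp only [addPair, add_zero, Finset.insert_idem]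
  exact Finset.card_insert_le _ _

theorem CrossAdjacent.addPair {W : Finset (Vertex k m)} (h : CrossAdjacent G W) {i : Fin k}
    {y e : Fin m → ZMod 2} (hy : y ∈ goodPairs G W i e) : CrossAdjacent G (addPair W i y e) := by
  obtain ⟨h1, h2⟩ := Finset.mem_filter.1 hy
  rw [mem_goodStrings] at h1 h2
  intro u hu v hv huv
  rw [mem_addPair] at hu hv
  rcases hu with rfl | rfl | hu <;> rcases hv with rfl | rfl | hv
  · exact absurd rfl huv
  · exact absurd rfl huv
  · exact (h1 v hv).symm
  · exact absurd rfl huv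
  · exact absurd rfl huv
  · exact (h2 v hv).symm
  · exact h1 u hu
  · exact h2 u hu
  · exact h u hu v hv huv

theorem CrossAdjacent.mono {W W' : Finset (Vertex k m)} (h : CrossAdjacent G W') (hs : W ⊆ W') :
    CrossAdjacent G W :=
  fun u hu v hv => h u (hs hu) v (hs hv)

/-- Greedy extension of a cross-adjacent set by a pair of vertices in every block of `J`. -/
theorem ManyCommonNbrs.exists_pairs (hG : ManyCommonNbrs G R) {W : Finset (Vertex k m)}
    (hW : CrossAdjacent G W) (e : Fin k → Fin m → ZMod 2) (c : ℕ)
    (hc : ∀ W i y, (BinClique.addPair W i y (e i)).card ≤ W.card + c) (J : Finset (Fin k))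
    (hJ : ∀ i ∈ J, i ∉ blocks W) (hR : W.card + c * J.card ≤ R) :
    ∃ (y : Fin k → Fin m → ZMod 2) (W' : Finset (Vertex k m)), W ⊆ W' ∧ CrossAdjacent G W' ∧
      blocks W' = blocks W ∪ J ∧ W'.card ≤ W.card + c * J.card ∧
      ∀ i ∈ J, (i, y i) ∈ W' ∧ (i, y i + e i) ∈ W' := by
  induction J using Finset.induction_on with
  | empty => exact ⟨fun _ => 0, W, subset_rfl, hW, by simp, by simp, by simp⟩
  | insert a J ha ih =>
    rw [Finset.card_insert_of_notMem ha, mul_add, mul_one] at hR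
    obtain ⟨y, W', h1, h2, h3, h4, h5⟩ :=
      ih (fun i hi => hJ i (Finset.mem_insert_of_mem hi)) (by omega)
    have haW : a ∉ blocks W' := by
      rw [h3, Finset.mem_union, not_or]
      exact ⟨hJ a (Finset.mem_insert_self _ _), ha⟩
    obtain ⟨z, hz⟩ := hG.goodPairs_nonempty (W := W') (by omega) haW (e a)
    refine ⟨Function.update y a z, BinClique.addPair W' a z (e a), h1.trans subset_addPair,
      h2.addPair hz, ?_, ?_, ?_⟩
    · ext j
      rw [mem_blocks_addPair, h3]
      simp only [Finset.mem_union, Finset.mem_insert]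
      tauto
    · have := hc W' a z
      rw [Finset.card_insert_of_notMem ha, mul_add, mul_one]
      omega
    · intro i hi
      by_cases hia : i = a
      · subst hia
        simp [mem_addPair]
      · have hiJ : i ∈ J := (Finset.mem_insert.1 hi).resolve_left hia
        rw [Function.update_of_ne hia]
        exact ⟨subset_addPair (h5 i hiJ).1, subset_addPair (h5 i hiJ).2⟩

end Graph

/-! ### Restrictions -/

/-- The assignment space of `NonEdge_M`. -/
abbrev Inputs {k m : ℕ} (M : Finset (Vertex k m)) : Type := Assignment (FreeVar M)

/-- The affine map `x ↦ A x + b` fixes the blocks outside of `W ⊇ M`, selects vertices of the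
cross-adjacent set `W` in the blocks of `W`, and does not depend on the input in those blocks. -/
structure IsRestriction {k m : ℕ} (G : SimpleGraph (Vertex k m)) (M W : Finset (Vertex k m))
    (A : Inputs M →ₗ[ZMod 2] Inputs M) (b : Inputs M) : Prop where
  subset : M ⊆ W
  cross : CrossAdjacent G W
  free : ∀ (x : Inputs M) (p : FreeVar M), p.1.1 ∉ blocks W → (A x + b) p = x p
  sel : ∀ (x : Inputs M) (i : FreeBlock M), i.1 ∈ blocks W → selected (A x + b) i ∈ W
  dep : ∀ x : Inputs M, (∀ p : FreeVar M, p.1.1 ∉ blocks W → x p = 0) → A x = 0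

section Restriction

variable {k m R : ℕ} {G : SimpleGraph (Vertex k m)} {M W : Finset (Vertex k m)}
  {A : Inputs M →ₗ[ZMod 2] Inputs M} {b : Inputs M}

theorem isRestriction_id (hM : CrossAdjacent G M) : IsRestriction G M M LinearMap.id 0 where
  subset := subset_rfl
  cross := hM
  free x p _ := by simp
  sel x i hi := absurd hi i.2
  dep x hx := funext fun p => hx p p.1.2

/-- `x` with the variables of block `i` set to zero. -/
def clearBlock (i : FreeBlock M) : Inputs M →ₗ[ZMod 2] Inputs M :=
  LinearMap.pi fun p => if p.1 = i then 0 else LinearMap.proj p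

/-- The assignment that is `z` on block `i` and zero elsewhere. -/
def embedBlock (i : FreeBlock M) : (Fin m → ZMod 2) →ₗ[ZMod 2] Inputs M :=
  LinearMap.pi fun p => if p.1 = i then LinearMap.proj p.2 else 0

theorem clearBlock_apply (i : FreeBlock M) (x : Inputs M) (p : FreeVar M) :
    clearBlock i x p = if p.1 = i then 0 else x p := by
  by_cases h : p.1 = i <;> simp [clearBlock, h]

theorem embedBlock_apply (i : FreeBlock M) (z : Fin m → ZMod 2) (p : FreeVar M) :
    embedBlock i z p = if p.1 = i then z p.2 else 0 := by
  by_cases h : p.1 = i <;> simp [embedBlock, h]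

theorem clearBlock_add_embedBlock (i : FreeBlock M) (x : Inputs M) :
    clearBlock i x + embedBlock i (fun j => x (i, j)) = x := by
  ext ⟨a, j⟩
  rw [Pi.add_apply, clearBlock_apply, embedBlock_apply]
  by_cases h : a = i
  · subst h; simp
  · simp [h]

/-- The unit vector of the variable `(i, j)`. -/
def unitVec (i : FreeBlock M) (j : Fin m) : Inputs M := embedBlock i (Pi.single j 1)

theorem unitVec_eq (i : FreeBlock M) (j : Fin m) : unitVec i j = Pi.single (i, j) 1 := by
  ext ⟨a, l⟩
  rw [unitVec, embedBlock_apply]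
  by_cases h : a = i
  · subst h
    by_cases h2 : l = j
    · subst h2; simp
    · have : (a, l) ≠ (a, j) := fun h => h2 (Prod.mk.inj h).2
      simp [h2]
  · have : (a, l) ≠ (i, j) := fun h' => h (Prod.mk.inj h').1
    simp [h, this]

/-- Linear part in the free variables of the substitution that solves `φ(x) = const` for the
variable `(i, j)`. -/
def solveLin (φ : LinForm (FreeVar M)) (i : FreeBlock M) (j : Fin m) :
    Inputs M →ₗ[ZMod 2] Inputs M :=
  clearBlock i + (φ ∘ₗ clearBlock i).smulRight (unitVec i j)

/-- Linear part in the string `z` of the substitution that solves `φ(x) = z j + const` for the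
variable `(i, j)` and sets the other variables of block `i` according to `z`. -/
def solveStr (φ : LinForm (FreeVar M)) (i : FreeBlock M) (j : Fin m) :
    (Fin m → ZMod 2) →ₗ[ZMod 2] Inputs M :=
  embedBlock i + (LinearMap.proj j + φ ∘ₗ embedBlock i).smulRight (unitVec i j)

theorem solveLin_apply (φ : LinForm (FreeVar M)) (i : FreeBlock M) (j : Fin m) (x : Inputs M) :
    solveLin φ i j x = clearBlock i x + φ (clearBlock i x) • unitVec i j := by
  simp [solveLin]

theorem solveStr_apply (φ : LinForm (FreeVar M)) (i : FreeBlock M) (j : Fin m)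
    (z : Fin m → ZMod 2) :
    solveStr φ i j z = embedBlock i z + (z j + φ (embedBlock i z)) • unitVec i j := by
  simp [solveStr]

/-- The free part and the string part of the substitution together lose no direction: `z = e_j`
produces the unit vector of `(i, j)`, which repairs the solved bit. This is the covering hypothesis
of `finrank_range_le_add`. -/
theorem solve_decomp {φ : LinForm (FreeVar M)} {i : FreeBlock M} {j : Fin m}
    (hφ : φ (unitVec i j) = 1) (v : Inputs M) :
    ∃ x z, v = solveLin φ i j x + solveStr φ i j z := by
  have hj : solveStr φ i j (Pi.single j 1) = unitVec i j := by
    rw [solveStr_apply]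
    change unitVec i j + (_ + φ (unitVec i j)) • _ = _
    rw [hφ, Pi.single_eq_same, CharTwo.add_self_eq_zero, zero_smul, add_zero]
  set y : Fin m → ZMod 2 := fun l => v (i, l)
  refine ⟨v, y + (φ (clearBlock i v) + (y j + φ (embedBlock i y))) • Pi.single j 1, ?_⟩
  rw [map_add, map_smul, hj, solveLin_apply, solveStr_apply]
  conv_lhs => rw [← clearBlock_add_embedBlock i v]
  have : ∀ (p q u : Inputs M) (s t : ZMod 2),
      p + s • u + (q + t • u + (s + t) • u) = p + q + ((s + s) + (t + t)) • u := by
    intros; module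
  rw [this, CharTwo.add_self_eq_zero, CharTwo.add_self_eq_zero]
  simp [y]

theorem apply_solve {φ : LinForm (FreeVar M)} {i : FreeBlock M} {j : Fin m}
    (hφ : φ (unitVec i j) = 1) (x : Inputs M) (z : Fin m → ZMod 2) (a : ZMod 2) :
    φ (solveLin φ i j x + solveStr φ i j z + a • unitVec i j) = z j + a := by
  rw [solveLin_apply, solveStr_apply]
  simp only [map_add, map_smul, hφ, smul_eq_mul, mul_one]
  linear_combination CharTwo.add_self_eq_zero (φ (clearBlock i x)) +
    CharTwo.add_self_eq_zero (φ (embedBlock i z))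

/-- Bit `j` of block `i` depends on the free variables, so the selected vertex is `z` or `z + e_j`.
Both lie in the enlarged set, so cross-adjacency is safe for either value. -/
theorem IsRestriction.step (h : IsRestriction G M W A b) {φ : LinForm (FreeVar M)}
    {i : FreeBlock M} {j : Fin m} (hi : i.1 ∉ blocks W) (hφ : φ (unitVec i j) = 1)
    (hdep : ∀ x : Inputs M, (∀ p : FreeVar M, p.1.1 ∉ blocks W → x p = 0) → φ x = 0)
    {z : Fin m → ZMod 2} (hz : z ∈ goodPairs G W i.1 (Pi.single j 1)) (a : ZMod 2) :
    IsRestriction G M (addPair W i.1 z (Pi.single j 1)) (A ∘ₗ solveLin φ i j)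
      (A (solveStr φ i j z + a • unitVec i j) + b) := by
  have happ : ∀ x, (A ∘ₗ solveLin φ i j) x + (A (solveStr φ i j z + a • unitVec i j) + b) =
      A (solveLin φ i j x + solveStr φ i j z + a • unitVec i j) + b := by
    intro x
    simp only [LinearMap.comp_apply, map_add]
    abel
  have hval : ∀ x, ∃ t : ZMod 2, solveLin φ i j x + solveStr φ i j z + a • unitVec i j =
      clearBlock i x + embedBlock i (z + t • Pi.single j 1) := by
    intro x
    refine ⟨φ (clearBlock i x) + (z j + φ (embedBlock i z)) + a, ?_⟩
    rw [solveLin_apply, solveStr_apply, map_add, map_smul]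
    change _ = _ + (_ + _ • unitVec i j)
    module
  refine ⟨h.subset.trans subset_addPair, h.cross.addPair hz, ?_, ?_, ?_⟩
  · intro x p hp
    rw [mem_blocks_addPair, not_or] at hp
    rw [happ, h.free _ _ hp.2]
    obtain ⟨t, ht⟩ := hval x
    have hpi : p.1 ≠ i := fun e => hp.1 (congrArg Subtype.val e)
    rw [ht, Pi.add_apply, clearBlock_apply, embedBlock_apply, if_neg hpi, if_neg hpi, add_zero]
  · intro x l hl
    rw [mem_blocks_addPair] at hl
    rw [happ]
    by_cases hlW : l.1 ∈ blocks W
    · exact subset_addPair (h.sel _ l hlW)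
    · have hli : l = i := Subtype.ext (hl.resolve_right hlW)
      subst hli
      obtain ⟨t, ht⟩ := hval x
      have : selected (A (solveLin φ l j x + solveStr φ l j z + a • unitVec l j) + b) l =
          (l.1, z + t • Pi.single j 1) := by
        refine Prod.ext rfl (funext fun q => ?_)
        change (A _ + b) (l, q) = _
        rw [h.free _ _ hlW, ht, Pi.add_apply, clearBlock_apply, embedBlock_apply]
        simp
      rw [this, mem_addPair]
      have ht2 : t = 0 ∨ t = 1 := (by decide : ∀ t : ZMod 2, t = 0 ∨ t = 1) t
      rcases ht2 with rfl | rfl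
      · left; simp
      · right; left; simp
  · intro x hx
    have hc : ∀ p : FreeVar M, p.1.1 ∉ blocks W → clearBlock i x p = 0 := by
      intro p hp
      rw [clearBlock_apply]
      split_ifs with hpi
      · rfl
      · refine hx p ?_
        rw [mem_blocks_addPair, not_or]
        exact ⟨fun e => hpi (Subtype.ext e), hp⟩
    rw [LinearMap.comp_apply, solveLin_apply, hdep _ hc, zero_smul, add_zero, h.dep _ hc]

end Restriction

end BinClique

namespace BinClique

/-! ### Restrictions never reach a leaf. -/

section Leaf

variable {k m R : ℕ} {G : SimpleGraph (Vertex k m)} {M W : Finset (Vertex k m)}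
  {A : Inputs M →ₗ[ZMod 2] Inputs M} {b : Inputs M}

/-- No pair of vertices is a correct output on all inputs of `NonEdge_W`. -/
theorem ManyCommonNbrs.not_forall_nonEdgeRel (hG : ManyCommonNbrs G R) (hR : 0 < R)
    (hW : W.card ≤ R) (o : VertexPair k m) :
    ∃ x ∈ nonEdgeInputs G W, ¬ nonEdgeRel G W x o := by
  classical
  obtain ⟨e, he⟩ := o
  induction e using Sym2.ind with
  | _ p q =>
  have hex : ∀ i : FreeBlock W, ∃ y, y ∈ goodStrings G W i.1 := fun i => by
    obtain ⟨y, hy⟩ := hG.goodPairs_nonempty hW i.2 0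
    exact ⟨y, (Finset.mem_filter.1 hy).1⟩
  choose y hy using hex
  by_cases hq : q.1 ∈ blocks W
  -- An endpoint in a committed block is never selected, so any input refutes the pair.
  · refine ⟨fun v => y v.1 v.2, fun i => ⟨rfl, mem_goodStrings.1 (hy i)⟩, ?_⟩
    rintro ⟨i, j, hij, -⟩
    rcases Sym2.eq_iff.1 hij with ⟨-, h⟩ | ⟨-, h⟩
    · exact j.2 (by rw [h] at hq; exact hq)
    · exact i.2 (by rw [h] at hq; exact hq)
  by_cases hp : p.1 ∈ blocks W
  · refine ⟨fun v => y v.1 v.2, fun i => ⟨rfl, mem_goodStrings.1 (hy i)⟩, ?_⟩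
    rintro ⟨i, j, hij, -⟩
    rcases Sym2.eq_iff.1 hij with ⟨h, -⟩ | ⟨h, -⟩
    · exact i.2 (by rw [h] at hp; exact hp)
    · exact j.2 (by rw [h] at hp; exact hp)
  by_cases hpq : p.1 = q.1
  · refine ⟨fun v => y v.1 v.2, fun i => ⟨rfl, mem_goodStrings.1 (hy i)⟩, ?_⟩
    rintro ⟨i, j, hij, -⟩
    refine he ?_
    rw [Sym2.mk_isDiag_iff]
    rcases Sym2.eq_iff.1 hij with ⟨h, h'⟩ | ⟨h, h'⟩
    · have : i = j := Subtype.ext (by rw [h, h'] at hpq; exact hpq)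
      rw [h, h', this]
    · have : j = i := Subtype.ext (by rw [h, h'] at hpq; exact hpq)
      rw [h, h', this]
  set i₀ : FreeBlock W := ⟨p.1, hp⟩
  set j₀ : FreeBlock W := ⟨q.1, hq⟩
  have hne : i₀ ≠ j₀ := fun h => hpq (congrArg Subtype.val h)
  set u : Vertex k m := (p.1, y i₀)
  have hj₀ : q.1 ∉ blocks {u} := by
    rw [mem_blocks]
    rintro ⟨v, hv, hv2⟩
    rw [Finset.mem_singleton.1 hv] at hv2
    exact hpq hv2
  have h1 := hG W hW q.1 hq
  have h2 := hG {u} (by rw [Finset.card_singleton]; omega) q.1 hj₀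
  -- Two sets of density at least `49/50` intersect, so the vertex in block `q.1` can be adjacent
  -- both to `W` and to `u`, which destroys the claimed non-edge.
  obtain ⟨z, hz⟩ : (goodStrings G W q.1 ∩ goodStrings G {u} q.1).Nonempty := by
    rw [← Finset.card_pos]
    have h3 := Finset.card_union_add_card_inter (goodStrings G W q.1) (goodStrings G {u} q.1)
    have h4 : (goodStrings G W q.1 ∪ goodStrings G {u} q.1).card ≤ 2 ^ m := by
      refine (Finset.card_le_univ _).trans ?_
      simp [ZMod.card]
    have : 0 < 2 ^ m := by positivity
    omega
  obtain ⟨hz1, hz2⟩ := Finset.mem_inter.1 hz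
  have hadj : G.Adj u (q.1, z) := mem_goodStrings.1 hz2 u (Finset.mem_singleton_self _)
  let x : Assignment (FreeVar W) := fun v => Function.update y j₀ z v.1 v.2
  have hxj : selected x j₀ = (q.1, z) := by
    refine Prod.ext rfl (funext fun l => ?_)
    simp [selected, x]
  have hxi : ∀ i, i ≠ j₀ → selected x i = (i.1, y i) := by
    intro i hi
    refine Prod.ext rfl (funext fun l => ?_)
    simp [selected, x, Function.update_of_ne hi]
  refine ⟨x, fun i => ⟨rfl, ?_⟩, ?_⟩
  · by_cases hi : i = j₀
    · subst hi
      rw [hxj]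
      exact mem_goodStrings.1 hz1
    · rw [hxi i hi]
      exact mem_goodStrings.1 (hy i)
  · rintro ⟨i, j, hij, hnadj⟩
    rcases Sym2.eq_iff.1 hij with ⟨h, h'⟩ | ⟨h, h'⟩
    · have hi : i = i₀ := Subtype.ext (congrArg Prod.fst h).symm
      have hj : j = j₀ := Subtype.ext (congrArg Prod.fst h').symm
      rw [hi, hj, hxj, hxi i₀ hne] at hnadj
      exact hnadj hadj
    · have hj : j = i₀ := Subtype.ext (congrArg Prod.fst h).symm
      have hi : i = j₀ := Subtype.ext (congrArg Prod.fst h').symm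
      rw [hi, hj, hxj, hxi i₀ hne] at hnadj
      exact hnadj hadj.symm

/-- The extension by zero of an assignment to the variables outside of the blocks of `W ⊇ M`. -/
def extendZero (M W : Finset (Vertex k m)) : Assignment (FreeVar W) →ₗ[ZMod 2] Inputs M :=
  LinearMap.pi fun p => if h : p.1.1 ∉ blocks W then LinearMap.proj (⟨p.1.1, h⟩, p.2) else 0

theorem extendZero_apply {p : FreeVar M} (h : p.1.1 ∉ blocks W) (x : Assignment (FreeVar W)) :
    extendZero M W x p = x (⟨p.1.1, h⟩, p.2) := by
  simp [extendZero, h]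

theorem IsRestriction.selected_eq (h : IsRestriction G M W A b) (x : Assignment (FreeVar W))
    {i : FreeBlock M} (hi : i.1 ∉ blocks W) :
    selected (A (extendZero M W x) + b) i = selected x ⟨i.1, hi⟩ :=
  Prod.ext rfl (funext fun _ => (h.free _ _ hi).trans (extendZero_apply hi x))

theorem IsRestriction.mem_nonEdgeInputs (h : IsRestriction G M W A b)
    {x : Assignment (FreeVar W)} (hx : x ∈ nonEdgeInputs G W) :
    A (extendZero M W x) + b ∈ nonEdgeInputs G M := by
  refine fun i => ⟨rfl, fun u hu => ?_⟩
  by_cases hi : i.1 ∈ blocks W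
  · refine h.cross u (h.subset hu) _ (h.sel _ i hi) fun e => i.2 ?_
    have := fst_mem_blocks hu
    rwa [e] at this
  · rw [h.selected_eq x hi]
    exact (hx ⟨i.1, hi⟩).2 u (h.subset hu)

/-- Vertices selected in committed blocks are adjacent to each other and, as members of `W`, to
every vertex selected in a free block. A non-edge must therefore join two free blocks, where the
restriction changes nothing. -/
theorem IsRestriction.nonEdgeRel (h : IsRestriction G M W A b)
    {x : Assignment (FreeVar W)} (hx : x ∈ nonEdgeInputs G W) {o : VertexPair k m}
    (ho : nonEdgeRel G M (A (extendZero M W x) + b) o) : nonEdgeRel G W x o := by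
  obtain ⟨i, j, hij, hadj⟩ := ho
  have hne : i ≠ j := by
    rintro rfl
    exact o.2 (by rw [hij]; simp)
  have hne' : i.1 ≠ j.1 := fun e => hne (Subtype.ext e)
  by_cases hi : i.1 ∈ blocks W <;> by_cases hj : j.1 ∈ blocks W
  · exact absurd (h.cross _ (h.sel _ i hi) _ (h.sel _ j hj) hne') hadj
  · rw [h.selected_eq x hj] at hadj
    exact absurd ((hx ⟨j.1, hj⟩).2 _ (h.sel _ i hi)) hadj
  · rw [h.selected_eq x hi] at hadj
    exact absurd ((hx ⟨i.1, hi⟩).2 _ (h.sel _ j hj)).symm hadj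
  · rw [h.selected_eq x hi, h.selected_eq x hj] at hadj hij
    exact ⟨_, _, hij, hadj⟩

theorem IsRestriction.not_isLeaf (h : IsRestriction G M W A b) (hG : ManyCommonNbrs G R)
    (hR : 0 < R) (hW : W.card ≤ R) {B : AffineDAG (FreeVar M)} (hB : SolvesNonEdge G M B)
    {v : B.Node} (hv : ∀ x, A x + b ∈ B.label v) : ¬ B.IsLeaf v := by
  intro hleaf
  obtain ⟨o, ho⟩ := hB v hleaf
  obtain ⟨x, hx, hno⟩ := hG.not_forall_nonEdgeRel hR hW o
  exact hno (h.nonEdgeRel hx (ho _ (h.mem_nonEdgeInputs hx) (hv _)))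

end Leaf

/-! ### Paths and restricted DAGs -/

section Path

theorem HasPath.append {N : Type} {E : N → N → Prop} {u v w : N} {l l' : ℕ}
    (h : HasPath E u v l) (h' : HasPath E v w l') : HasPath E u w (l + l') := by
  induction h with
  | nil => simpa using h'
  | cons he _ ih =>
    have := HasPath.cons he (ih h')
    rwa [Nat.add_right_comm] at this

theorem HasPath.map {N N' : Type} {E : N → N → Prop} {E' : N' → N' → Prop} (f : N → N')
    (hf : ∀ u v, E u v → E' (f u) (f v)) {u v : N} {l : ℕ} (h : HasPath E u v l) :
    HasPath E' (f u) (f v) l := by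
  induction h with
  | nil => exact HasPath.nil _
  | cons he _ ih => exact HasPath.cons (hf _ _ he) ih

theorem AffineDAG.exists_leaf {ι : Type} (B : AffineDAG ι) (v : B.Node) :
    ∃ (w : B.Node) (l : ℕ), B.IsLeaf w ∧ HasPath (IsChild B.step) v w l := by
  have := B.finite
  let r : B.Node → B.Node → Prop := fun a b => Relation.TransGen (IsChild B.step) b a
  have hirr : Std.Irrefl r := ⟨fun a => B.acyclic a⟩
  have htr : IsTrans B.Node r := ⟨fun _ _ _ h h' => Relation.TransGen.trans h' h⟩
  have hwf : WellFounded r := Finite.wellFounded_of_trans_of_irrefl r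
  induction v using hwf.induction with
  | _ v ih =>
  rcases hs : B.step v with _ | ⟨P, c⟩
  · exact ⟨v, 0, hs, HasPath.nil v⟩
  · have hch : IsChild B.step v (c 0) := ⟨P, c, 0, hs, rfl⟩
    obtain ⟨w, l, hw, hl⟩ := ih (c 0) (Relation.TransGen.single hch)
    exact ⟨w, l + 1, hw, HasPath.cons hch hl⟩

theorem AffineDAG.DepthAtMost.path_le {ι : Type} {B : AffineDAG ι} {D : ℕ}
    (hD : B.DepthAtMost D) {v : B.Node} {l : ℕ} (h : HasPath (IsChild B.step) B.root v l) :
    l ≤ D := by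
  obtain ⟨w, l', hw, hl'⟩ := B.exists_leaf v
  have := hD w _ hw (h.append hl')
  omega

variable {ι κ : Type}

/-- The nodes reachable from `v`. -/
abbrev AffineDAG.Below (B : AffineDAG ι) (v : B.Node) : Type :=
  {w : B.Node // Relation.ReflTransGen (IsChild B.step) v w}

/-- The nodes reachable from `v`, with queries and labels pulled back along `x ↦ L x + b`. -/
def AffineDAG.restrictStep (B : AffineDAG ι) (v : B.Node)
    (L : Assignment κ →ₗ[ZMod 2] Assignment ι) (b : Assignment ι) (w : B.Below v) :
    Option (LinForm κ × (ZMod 2 → B.Below v)) :=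
  match h : B.step w.1 with
  | none => none
  -- The pulled-back query drops the constant `P b`, so answer `t` of `P ∘ L` is answer `t + P b` of
  -- `P`.
  | some (P, c) => some (P ∘ₗ L, fun t =>
      ⟨c (t + P b), w.2.tail ⟨P, c, t + P b, h, rfl⟩⟩)

variable (B : AffineDAG ι) (v : B.Node) (L : Assignment κ →ₗ[ZMod 2] Assignment ι)
  (b : Assignment ι)

theorem AffineDAG.restrictStep_eq_none {w : B.Below v} :
    B.restrictStep v L b w = none ↔ B.step w.1 = none := by
  unfold AffineDAG.restrictStep
  split <;> simp_all

theorem AffineDAG.restrictStep_eq_some {w : B.Below v} {Q : LinForm κ}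
    {c' : ZMod 2 → B.Below v} (h : B.restrictStep v L b w = some (Q, c')) :
    ∃ P c, B.step w.1 = some (P, c) ∧ Q = P ∘ₗ L ∧ ∀ t, (c' t).1 = c (t + P b) := by
  unfold AffineDAG.restrictStep at h
  split at h
  · simp at h
  · rename_i P c hs
    simp only [Option.some.injEq, Prod.mk.injEq] at h
    obtain ⟨rfl, rfl⟩ := h
    exact ⟨P, c, hs, rfl, fun t => rfl⟩

theorem AffineDAG.isChild_of_restrict {w w' : B.Below v}
    (h : IsChild (B.restrictStep v L b) w w') : IsChild B.step w.1 w'.1 := by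
  obtain ⟨Q, c', t, hs, rfl⟩ := h
  obtain ⟨P, c, hs', -, hc⟩ := B.restrictStep_eq_some v L b hs
  exact ⟨P, c, _, hs', (hc t).symm⟩

theorem AffineDAG.restrict_isChild {w w' : B.Below v} (h : IsChild B.step w.1 w'.1) :
    IsChild (B.restrictStep v L b) w w' := by
  obtain ⟨P, c, t, hs, hc⟩ := h
  rcases hr : B.restrictStep v L b w with _ | ⟨Q, c'⟩
  · rw [B.restrictStep_eq_none, hs] at hr
    simp at hr
  · obtain ⟨P', c₁, hs', -, hc'⟩ := B.restrictStep_eq_some v L b hr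
    rw [hs, Option.some.injEq, Prod.mk.injEq] at hs'
    obtain ⟨rfl, rfl⟩ := hs'
    refine ⟨Q, c', t + P b, hr, Subtype.ext ?_⟩
    rw [hc', ← hc, add_assoc, CharTwo.add_self_eq_zero, add_zero]

/-- The sub-DAG below `v`, restricted along an affine map into the label of `v`. -/
def AffineDAG.restrict (hv : ∀ x, L x + b ∈ B.label v) : AffineDAG κ where
  Node := B.Below v
  finite := by have := B.finite; infer_instance
  root := ⟨v, Relation.ReflTransGen.refl⟩
  label w := (B.label w.1).comap (L.toAffineMap + AffineMap.const _ _ b)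
  step := B.restrictStep v L b
  acyclic w h := B.acyclic w.1 (Relation.TransGen.lift (p := IsChild B.step)
    (Subtype.val : B.Below v → B.Node) (fun _ _ => B.isChild_of_restrict v L b) w w h)
  reachable := by
    rintro ⟨w, hw⟩
    induction hw with
    | refl => exact Relation.ReflTransGen.refl
    | tail hu hc ih => exact ih.tail (B.restrict_isChild v L b hc)
  label_root := by
    ext x
    simpa using hv x
  label_child := by
    intro w Q c' hs t x hx hQ
    obtain ⟨P, c, hs', rfl, hc⟩ := B.restrictStep_eq_some v L b hs
    simp only [AffineSubspace.mem_comap, hc] at hx ⊢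
    refine B.label_child w.1 P c hs' _ _ hx ?_
    simp only [LinearMap.comp_apply] at hQ
    simp [hQ]

theorem AffineDAG.size_restrict_le (hv : ∀ x, L x + b ∈ B.label v) :
    (B.restrict v L b hv).size ≤ B.size := by
  have := B.finite
  exact Finite.card_subtype_le _

theorem AffineDAG.DepthAtMost.restrict {B : AffineDAG ι} {v : B.Node}
    {L : Assignment κ →ₗ[ZMod 2] Assignment ι} {b : Assignment ι}
    (hv : ∀ x, L x + b ∈ B.label v) {D d : ℕ} (hD : B.DepthAtMost D)
    (hd : HasPath (IsChild B.step) B.root v d) :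
    (B.restrict v L b hv).DepthAtMost (D - d) := by
  intro w l hw hl
  have hw' : B.IsLeaf w.1 := (B.restrictStep_eq_none v L b).1 hw
  have := hD w.1 _ hw'
    (hd.append (hl.map Subtype.val fun _ _ => B.isChild_of_restrict v L b))
  omega

end Path

theorem IsRestriction.solvesNonEdge_restrict {k m : ℕ} {G : SimpleGraph (Vertex k m)}
    {M W : Finset (Vertex k m)} {A : Inputs M →ₗ[ZMod 2] Inputs M} {b : Inputs M}
    (h : IsRestriction G M W A b) {B : AffineDAG (FreeVar M)} (hB : SolvesNonEdge G M B)
    {v : B.Node} (hv : ∀ x, (A ∘ₗ extendZero M W) x + b ∈ B.label v) :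
    SolvesNonEdge G W (B.restrict v (A ∘ₗ extendZero M W) b hv) := by
  intro w hw
  obtain ⟨o, ho⟩ := hB w.1 ((B.restrictStep_eq_none v _ b).1 hw)
  refine ⟨o, fun x hx hxw => h.nonEdgeRel hx (ho _ (h.mem_nonEdgeInputs hx) ?_)⟩
  have := AffineSubspace.mem_comap.1 hxw
  simpa using this

end BinClique

namespace BinClique

/-! ### Codimension and rank modulo an affine subspace. -/

section Codim

variable {V : Type*} [AddCommGroup V] [Module (ZMod 2) V]

/-- The rank of the linear map `A` modulo the direction of the affine subspace `F`. -/
noncomputable def relRank (F : AffineSubspace (ZMod 2) V) (A : V →ₗ[ZMod 2] V) : ℕ :=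
  Module.finrank (ZMod 2) (LinearMap.range (F.direction.mkQ ∘ₗ A))

/-- The codimension of the direction of an affine subspace. -/
noncomputable def codim (F : AffineSubspace (ZMod 2) V) : ℕ :=
  Module.finrank (ZMod 2) (V ⧸ F.direction)

theorem relRank_id (F : AffineSubspace (ZMod 2) V) : relRank F LinearMap.id = codim F := by
  unfold relRank codim
  rw [LinearMap.comp_id, Submodule.range_mkQ, finrank_top]

theorem mkQ_eq_of_mem {F : AffineSubspace (ZMod 2) V} {x y : V} (hx : x ∈ F) (hy : y ∈ F) :
    F.direction.mkQ x = F.direction.mkQ y := by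
  rw [← sub_eq_zero, ← map_sub, Submodule.mkQ_apply, Submodule.Quotient.mk_eq_zero]
  exact AffineSubspace.vsub_mem_direction hx hy

theorem mem_of_mkQ_eq {F : AffineSubspace (ZMod 2) V} {x y : V} (hx : x ∈ F)
    (h : F.direction.mkQ y = F.direction.mkQ x) : y ∈ F := by
  rw [← sub_eq_zero, ← map_sub, Submodule.mkQ_apply, Submodule.Quotient.mk_eq_zero] at h
  have := AffineSubspace.vadd_mem_of_mem_direction h hx
  simpa using this

theorem relRank_eq_zero {F : AffineSubspace (ZMod 2) V} {A : V →ₗ[ZMod 2] V} {b : V}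
    (h : ∀ x, A x + b ∈ F) : relRank F A = 0 := by
  have : F.direction.mkQ ∘ₗ A = 0 := by
    ext x
    have h1 := mkQ_eq_of_mem (h x) (h 0)
    rw [map_add, map_add, map_zero, map_zero, zero_add] at h1
    simpa using h1
  rw [relRank, this, LinearMap.range_zero, finrank_bot]

/-- Intersecting with a hyperplane increases the codimension by at most one. -/
theorem codim_le_add_one [FiniteDimensional (ZMod 2) V] {F F' : AffineSubspace (ZMod 2) V} (P : V →ₗ[ZMod 2] ZMod 2) {x₀ : V}
    (hx₀ : x₀ ∈ F) (h : ∀ x ∈ F, P x = P x₀ → x ∈ F') : codim F' ≤ codim F + 1 := by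
  have hdir : F.direction ⊓ LinearMap.ker P ≤ F'.direction := by
    rintro v ⟨hv, hP⟩
    have h1 : v + x₀ ∈ F := AffineSubspace.vadd_mem_of_mem_direction hv hx₀
    have h2 : v + x₀ ∈ F' := h _ h1 (by
      rw [map_add, LinearMap.mem_ker.1 hP, zero_add])
    have h3 := AffineSubspace.vsub_mem_direction h2 (h x₀ hx₀ rfl)
    simpa using h3
  have h1 := Submodule.finrank_mono hdir
  have h2 := Submodule.finrank_sup_add_finrank_inf_eq F.direction (LinearMap.ker P)
  have h3 := P.finrank_range_add_finrank_ker
  have h4 : Module.finrank (ZMod 2) (LinearMap.range P) ≤ 1 :=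
    (Submodule.finrank_le _).trans (Module.finrank_self _).le
  have h5 := Submodule.finrank_le (F.direction ⊔ LinearMap.ker P)
  have h6 := F.direction.finrank_quotient_add_finrank
  have h7 := F'.direction.finrank_quotient_add_finrank
  unfold codim
  omega

end Codim

/-! ### The random walk and a popular node. -/

section Walk

variable {k m R : ℕ} {G : SimpleGraph (Vertex k m)} {M W : Finset (Vertex k m)}
  {A : Inputs M →ₗ[ZMod 2] Inputs M} {b : Inputs M}

theorem exists_unitVec_ne_zero {φ : LinForm (FreeVar M)} (hφ : φ ≠ 0) :
    ∃ i j, φ (unitVec i j) = 1 := by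
  by_contra hcon
  push Not at hcon
  refine hφ (LinearMap.pi_ext' fun p => LinearMap.ext_ring ?_)
  have h2 : ∀ t : ZMod 2, t ≠ 1 → t = 0 := by decide
  have := h2 _ (hcon p.1 p.2)
  rw [unitVec_eq] at this
  simpa using this

/-- The number of strings `z` for which the substituted affine map meets `F`, in terms of the drop
of the rank. -/
theorem card_hits_mul_le {φ : LinForm (FreeVar M)} {i : FreeBlock M} {j : Fin m}
    (hφ : φ (unitVec i j) = 1) (F : AffineSubspace (ZMod 2) (Inputs M))
    (A : Inputs M →ₗ[ZMod 2] Inputs M) (b : Inputs M) (H : Finset (Fin m → ZMod 2))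
    (hH : ∀ z ∈ H, ∃ x, A (solveLin φ i j x) + (A (solveStr φ i j z) + b) ∈ F) :
    H.card * 2 ^ (relRank F A) ≤ 2 ^ m * 2 ^ relRank F (A ∘ₗ solveLin φ i j) := by
  set Λ := F.direction.mkQ ∘ₗ A with hΛ
  have h1 := finrank_range_le_add Λ (solveLin φ i j) (solveStr φ i j) (solve_decomp hφ)
  have h2 := card_mul_two_pow_finrank_range_le
    ((LinearMap.range (Λ ∘ₗ solveLin φ i j)).mkQ ∘ₗ Λ ∘ₗ solveStr φ i j) H (by
      intro z hz z' hz'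
      obtain ⟨x, hx⟩ := hH z hz
      obtain ⟨x', hx'⟩ := hH z' hz'
      have h := mkQ_eq_of_mem hx' hx
      rw [LinearMap.comp_apply, Submodule.mkQ_apply, Submodule.Quotient.mk_eq_zero]
      refine ⟨x' - x, ?_⟩
      simp only [hΛ, LinearMap.comp_apply, map_sub, map_add] at h ⊢
      rw [sub_eq_sub_iff_add_eq_add]
      have h' := congrArg (· - F.direction.mkQ b) h
      simp only [← add_assoc, add_sub_cancel_right] at h'
      rw [h', add_comm])
  have hcard : Fintype.card (Fin m → ZMod 2) = 2 ^ m := by simp [ZMod.card]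
  rw [hcard] at h2
  have h3 : relRank F A ≤ relRank F (A ∘ₗ solveLin φ i j) + Module.finrank (ZMod 2)
      (LinearMap.range ((LinearMap.range (Λ ∘ₗ solveLin φ i j)).mkQ ∘ₗ Λ ∘ₗ
        solveStr φ i j)) := h1
  calc H.card * 2 ^ relRank F A ≤ H.card * (2 ^ relRank F (A ∘ₗ solveLin φ i j) * 2 ^ _) :=
        Nat.mul_le_mul_left _ ((Nat.pow_le_pow_right two_pos h3).trans (pow_add _ _ _).le)
    _ = H.card * 2 ^ _ * 2 ^ relRank F (A ∘ₗ solveLin φ i j) := by ring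
    _ ≤ _ := Nat.mul_le_mul_right _ h2

theorem relRank_comp_le (F : AffineSubspace (ZMod 2) (Inputs M))
    (A σ : Inputs M →ₗ[ZMod 2] Inputs M) : relRank F (A ∘ₗ σ) ≤ relRank F A :=
  Submodule.finrank_mono (by
    rw [← LinearMap.comp_assoc]
    exact LinearMap.range_comp_le_range _ _)

/-- A fraction of `2 ^ (r' - r)` of all strings has weight at most `(3/4) ^ r'`, hence at least a
`0.96` fraction of all strings has average weight at most `(3/4) ^ r`. -/
theorem average_le {n H Z r r' : ℕ} (hn : 0 < n) (hr : r' ≤ r) (hZ : 24 * n ≤ 25 * Z)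
    (hHZ : H ≤ Z) (hH : H * 2 ^ r ≤ n * 2 ^ r') :
    (Z : ℝ)⁻¹ * (H * (3 / 4 : ℝ) ^ r') ≤ (3 / 4 : ℝ) ^ r := by
  have hZ0 : 0 < Z := by omega
  have hZ' : (0 : ℝ) < Z := by exact_mod_cast hZ0
  obtain ⟨s, rfl⟩ := Nat.exists_eq_add_of_le hr
  rw [inv_mul_le_iff₀ hZ', pow_add, mul_left_comm, mul_comm (H : ℝ)]
  refine mul_le_mul_of_nonneg_left ?_ (by positivity)
  rcases s with _ | s
  · rw [pow_zero, mul_one]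
    exact_mod_cast hHZ
  have h1 : H * 2 ^ (s + 1) ≤ n := by
    rw [pow_add 2 r', ← mul_assoc, mul_right_comm] at hH
    exact Nat.le_of_mul_le_mul_right hH (by positivity)
  have h1' : (H : ℝ) * 2 ^ (s + 1) ≤ n := by exact_mod_cast h1
  have h2 : (24 : ℝ) * n ≤ 25 * Z := by exact_mod_cast hZ
  -- The loss `25/24` from sampling only good strings is absorbed by `2 · 3/4 = 3/2`, available once
  -- the rank drops by at least one.
  have h3 : (3 / 2 : ℝ) ≤ (3 / 2) ^ (s + 1) := by
    have : (1 : ℝ) ≤ (3 / 2) ^ s := one_le_pow₀ (by norm_num)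
    rw [pow_succ]
    linarith
  have h4 : (3 / 2 : ℝ) ^ (s + 1) = (3 / 4) ^ (s + 1) * 2 ^ (s + 1) := by
    rw [← mul_pow]; norm_num
  have h5 : (H : ℝ) * 2 ^ (s + 1) ≤ Z * (3 / 4) ^ (s + 1) * 2 ^ (s + 1) := by
    rw [mul_assoc, ← h4]
    nlinarith
  exact le_of_mul_le_mul_right h5 (by positivity)

/-- A random walk of length `t` from `u`, given by the weights of its endpoints: an endpoint whose
label has rank `r` on the current restriction has weight at most `(3/4) ^ r`. -/
theorem exists_walk (hG : ManyCommonNbrs G R) (hR : 0 < R) {B : AffineDAG (FreeVar M)}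
    (hB : SolvesNonEdge G M B) [Fintype B.Node] (t : ℕ) :
    ∀ (u : B.Node) (W : Finset (Vertex k m)) (A : Inputs M →ₗ[ZMod 2] Inputs M) (b : Inputs M),
      IsRestriction G M W A b → W.card + 2 * t ≤ R → (∀ x, A x + b ∈ B.label u) →
      ∃ w : B.Node → ℝ, (∀ v, 0 ≤ w v) ∧ ∑ v, w v = 1 ∧
        (∀ v, w v ≤ (3 / 4 : ℝ) ^ relRank (B.label v) A) ∧
        ∀ v, w v ≠ 0 → HasPath (IsChild B.step) u v t ∧
          codim (B.label v) ≤ codim (B.label u) + t ∧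
          ∃ (W' : Finset (Vertex k m)) (A' : Inputs M →ₗ[ZMod 2] Inputs M) (b' : Inputs M),
            IsRestriction G M W' A' b' ∧ W'.card ≤ W.card + 2 * t ∧
            (∀ x, A' x + b' ∈ B.label v) ∧ ∃ x, b' = A x + b := by
  classical
  induction t with
  | zero =>
    intro u W A b h hW hu
    refine ⟨Pi.single u 1, fun v => ?_, by simp, fun v => ?_, fun v hv => ?_⟩
    · by_cases hv : v = u
      · subst hv; simp
      · simp [hv]
    · by_cases hv : v = u
      · subst hv
        simp [relRank_eq_zero hu]
      · rw [Pi.single_eq_of_ne hv]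
        positivity
    · have hv : v = u := by
        by_contra hne
        exact hv (by simp [hne])
      subst hv
      exact ⟨HasPath.nil _, le_rfl, W, A, b, h, le_rfl, hu, 0, by simp⟩
  | succ t ih =>
    intro u W A b h hW hu
    rcases hs : B.step u with _ | ⟨P, c⟩
    · exact absurd hs (h.not_isLeaf hG hR (by omega) hB hu)
    have hedge : ∀ s, IsChild B.step u (c s) := fun s => ⟨P, c, s, hs, rfl⟩
    have hcod : ∀ x, codim (B.label (c (P (A x + b)))) ≤ codim (B.label u) + 1 := fun x =>
      codim_le_add_one P (hu x) fun y hy hPy => B.label_child u P c hs _ y hy hPy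
    by_cases hφ : P ∘ₗ A = 0
    · have hconst : ∀ x, P (A x + b) = P b := fun x => by
        rw [map_add, ← LinearMap.comp_apply, hφ, LinearMap.zero_apply, zero_add]
      obtain ⟨w, hw0, hw1, hw2, hw3⟩ := ih (c (P b)) W A b h (by omega)
        fun x => B.label_child u P c hs _ _ (hu x) (hconst x)
      refine ⟨w, hw0, hw1, hw2, fun v hv => ?_⟩
      obtain ⟨p1, p2, W', A', b', p3, p4, p5⟩ := hw3 v hv
      have hc := hcod 0
      rw [hconst] at hc
      exact ⟨HasPath.cons (hedge _) p1, by omega, W', A', b', p3, by omega, p5⟩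
    · obtain ⟨i, j, hij⟩ := exists_unitVec_ne_zero hφ
      set φ := P ∘ₗ A with hφdef
      have hdep : ∀ x : Inputs M, (∀ p : FreeVar M, p.1.1 ∉ blocks W → x p = 0) → φ x = 0 :=
        fun x hx => by rw [hφdef, LinearMap.comp_apply, h.dep x hx, map_zero]
      -- By `dep`, the pulled-back form ignores committed blocks, so its pivot lies in a free block.
      have hi : i.1 ∉ blocks W := by
        intro hi
        have h0 := hdep (unitVec i j) fun p hp => by
          rw [unitVec, embedBlock_apply, if_neg]
          rintro rfl
          exact hp hi
        rw [hij] at h0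
        exact one_ne_zero h0
      set e : Fin m → ZMod 2 := Pi.single j 1
      set Z := goodPairs G W i.1 e
      have hZcard := hG.card_goodPairs (W := W) (by omega) hi e
      have hZne := hG.goodPairs_nonempty (W := W) (by omega) hi e
      -- The shift by `P b` cancels the constant term of the query, so its answer is `z j`.
      let b₁ : (Fin m → ZMod 2) → Inputs M := fun z =>
        A (solveStr φ i j z + P b • unitVec i j) + b
      have hin : ∀ x z, A (solveLin φ i j x) + b₁ z =
          A (solveLin φ i j x + solveStr φ i j z + P b • unitVec i j) + b := by
        intro x z
        simp only [b₁, map_add]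
        abel
      have hP : ∀ x z, P (A (solveLin φ i j x) + b₁ z) = z j := by
        intro x z
        have h1 := apply_solve hij x z (P b)
        rw [hin, map_add, ← LinearMap.comp_apply, h1, add_assoc, CharTwo.add_self_eq_zero, add_zero]
      have hb₁ : ∀ z, b₁ z = A (solveStr φ i j z + P b • unitVec i j) + b := fun z => rfl
      have hstep : ∀ z : Z, ∃ w : B.Node → ℝ, (∀ v, 0 ≤ w v) ∧ ∑ v, w v = 1 ∧
          (∀ v, w v ≤ (3 / 4 : ℝ) ^ relRank (B.label v) (A ∘ₗ solveLin φ i j)) ∧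
          ∀ v, w v ≠ 0 → HasPath (IsChild B.step) (c (z.1 j)) v t ∧
            codim (B.label v) ≤ codim (B.label (c (z.1 j))) + t ∧
            ∃ (W' : Finset (Vertex k m)) (A' : Inputs M →ₗ[ZMod 2] Inputs M) (b' : Inputs M),
              IsRestriction G M W' A' b' ∧ W'.card ≤ (addPair W i.1 z.1 e).card + 2 * t ∧
              (∀ x, A' x + b' ∈ B.label v) ∧ ∃ x, b' = (A ∘ₗ solveLin φ i j) x + b₁ z.1 := by
        intro z
        refine ih (c (z.1 j)) (addPair W i.1 z.1 e) (A ∘ₗ solveLin φ i j) (b₁ z.1)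
          (h.step hi hij hdep z.2 (P b)) ?_ fun x => ?_
        · have := card_addPair_le W i.1 z.1 e
          omega
        · refine B.label_child u P c hs _ _ ?_ (hP x z.1)
          rw [LinearMap.comp_apply, hin]
          exact hu _
      choose w hw0 hw1 hw2 hw3 using hstep
      have hZ0 : (0 : ℝ) < (Z.card : ℝ) := by exact_mod_cast hZne.card_pos
      refine ⟨fun v => (Z.card : ℝ)⁻¹ * ∑ z, w z v, fun v => ?_, ?_, fun v => ?_, fun v hv => ?_⟩
      · exact mul_nonneg (inv_nonneg.2 hZ0.le) (Finset.sum_nonneg fun z _ => hw0 z v)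
      · rw [← Finset.mul_sum, Finset.sum_comm]
        simp only [hw1, Finset.sum_const, Finset.card_univ, Fintype.card_coe, nsmul_eq_mul, mul_one]
        exact inv_mul_cancel₀ hZ0.ne'
      -- `H` collects the strings that give `v` positive weight. For each, the final base point
      -- shows that the substituted image meets the label of `v`, so `card_hits_mul_le` weighs the
      -- size of `H` against the rank drop.
      · set H : Finset Z := Finset.univ.filter fun z => w z v ≠ 0
        have hsum : ∑ z, w z v ≤
            H.card * (3 / 4 : ℝ) ^ relRank (B.label v) (A ∘ₗ solveLin φ i j) := by
          rw [← Finset.sum_filter_ne_zero, ← nsmul_eq_mul]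
          exact Finset.sum_le_card_nsmul _ _ _ fun z _ => hw2 z v
        have hHcard : (H.map (Function.Embedding.subtype _)).card = H.card := Finset.card_map _
        have hhit := card_hits_mul_le hij (B.label v) A (A (P b • unitVec i j) + b)
          (H.map (Function.Embedding.subtype _)) (by
            intro z hz
            obtain ⟨z', hz', rfl⟩ := Finset.mem_map.1 hz
            obtain ⟨-, -, W', A', b', -, -, hmem, x, hx⟩ := hw3 z' v (Finset.mem_filter.1 hz').2
            refine ⟨x, ?_⟩
            have := hmem 0
            rw [map_zero, zero_add, hx, hb₁, map_add, LinearMap.comp_apply] at this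
            simpa [add_assoc] using this)
        rw [hHcard] at hhit
        have hHZ : H.card ≤ Z.card := by
          have := Finset.card_le_univ H
          rwa [Fintype.card_coe] at this
        refine le_trans (mul_le_mul_of_nonneg_left hsum (inv_nonneg.2 hZ0.le)) ?_
        exact average_le (by positivity) (relRank_comp_le _ _ _) hZcard hHZ hhit
      · obtain ⟨z, -, hz⟩ := Finset.exists_ne_zero_of_sum_ne_zero (right_ne_zero_of_mul hv)
        obtain ⟨p1, p2, W', A', b', p3, p4, p5, x, hx⟩ := hw3 z v hz
        have hc := hcod (solveLin φ i j 0 + solveStr φ i j z.1 + P b • unitVec i j)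
        rw [← hin, hP] at hc
        have := card_addPair_le W i.1 z.1 e
        refine ⟨HasPath.cons (hedge _) p1, by omega, W', A', b', p3, by omega, p5,
          solveLin φ i j x + solveStr φ i j z.1 + P b • unitVec i j, ?_⟩
        · rw [hx, LinearMap.comp_apply, hin]

theorem exists_popular_node (hG : ManyCommonNbrs G R) (hR : 0 < R) (hM : CrossAdjacent G M)
    {B : AffineDAG (FreeVar M)} (hB : SolvesNonEdge G M B) {t : ℕ} (ht : M.card + 2 * t ≤ R) :
    ∃ (v : B.Node) (W : Finset (Vertex k m)) (A : Inputs M →ₗ[ZMod 2] Inputs M) (b : Inputs M),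
      HasPath (IsChild B.step) B.root v t ∧ codim (B.label v) ≤ t ∧
      (4 / 3 : ℝ) ^ codim (B.label v) ≤ B.size ∧
      IsRestriction G M W A b ∧ W.card ≤ M.card + 2 * t ∧ ∀ x, A x + b ∈ B.label v := by
  classical
  have := B.finite
  have : Fintype B.Node := Fintype.ofFinite _
  have hroot : ∀ x, (LinearMap.id : Inputs M →ₗ[ZMod 2] Inputs M) x + 0 ∈ B.label B.root := by
    intro x
    rw [B.label_root]
    trivial
  obtain ⟨w, hw0, hw1, hw2, hw3⟩ := exists_walk hG hR hB t B.root M LinearMap.id 0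
    (isRestriction_id hM) ht hroot
  have hsize : B.size = Fintype.card B.Node := Nat.card_eq_fintype_card
  have hpos : (0 : ℝ) < Fintype.card B.Node := by
    have : Nonempty B.Node := ⟨B.root⟩
    exact_mod_cast Fintype.card_pos
  obtain ⟨v, hv⟩ : ∃ v, (Fintype.card B.Node : ℝ)⁻¹ ≤ w v := by
    by_contra hcon
    push Not at hcon
    have := Finset.sum_lt_sum_of_nonempty (s := (Finset.univ : Finset B.Node))
      ⟨B.root, Finset.mem_univ _⟩ (fun v _ => hcon v)
    rw [hw1, Finset.sum_const, Finset.card_univ, nsmul_eq_mul, mul_inv_cancel₀ hpos.ne'] at this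
    exact lt_irrefl _ this
  obtain ⟨p1, p2, W, A, b, p3, p4, p5, -⟩ := hw3 v (ne_of_gt (lt_of_lt_of_le (inv_pos.2 hpos) hv))
  have hc0 : codim (B.label B.root) = 0 := by
    rw [← relRank_id]
    exact relRank_eq_zero hroot
  refine ⟨v, W, A, b, p1, by omega, ?_, p3, p4, p5⟩
  have h1 := hv.trans (hw2 v)
  rw [relRank_id] at h1
  rw [hsize]
  have h2 := inv_anti₀ (inv_pos.2 hpos) h1
  rw [inv_inv, ← inv_pow] at h2
  norm_num at h2 ⊢
  exact h2

/-- Otherwise a walk of length `D` is affordable; it ends at a non-leaf, and one more edge gives a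
path longer than the depth. -/
theorem lt_depth (hG : ManyCommonNbrs G R) (hR : 0 < R) (hM : CrossAdjacent G M)
    {B : AffineDAG (FreeVar M)} (hB : SolvesNonEdge G M B) {D : ℕ} (hD : B.DepthAtMost D) :
    R < M.card + 8 * D := by
  by_contra hcon
  obtain ⟨v, W, A, b, hpath, -, -, h, hW, hv⟩ :=
    exists_popular_node hG hR hM hB (t := D) (by omega)
  rcases hs : B.step v with _ | ⟨P, c⟩
  · exact h.not_isLeaf hG hR (by omega) hB hv hs
  · have hedge : IsChild B.step v (c 0) := ⟨P, c, 0, hs, rfl⟩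
    have := hD.path_le (hpath.append (HasPath.cons hedge (HasPath.nil _)))
    omega

end Walk

end BinClique

namespace BinClique

/-! ### Replacing the walk's restriction by a small one. -/

section Final

variable {k m R : ℕ} {G : SimpleGraph (Vertex k m)} {M W : Finset (Vertex k m)}
  {A : Inputs M →ₗ[ZMod 2] Inputs M} {b : Inputs M}

/-- Extension by zero of an assignment to the variables of `C`. -/
def extendVars (C : Finset (FreeVar M)) : (C → ZMod 2) →ₗ[ZMod 2] Inputs M :=
  LinearMap.pi fun p => if h : p ∈ C then LinearMap.proj ⟨p, h⟩ else 0

theorem extendVars_of_mem {C : Finset (FreeVar M)} {p : FreeVar M} (h : p ∈ C)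
    (s : C → ZMod 2) : extendVars C s p = s ⟨p, h⟩ := by
  simp [extendVars, h]

theorem extendVars_of_notMem {C : Finset (FreeVar M)} {p : FreeVar M} (h : p ∉ C)
    (s : C → ZMod 2) : extendVars C s p = 0 := by
  simp [extendVars, h]

theorem extendVars_single {C : Finset (FreeVar M)} (p : C) :
    extendVars C (Pi.single p 1) = Pi.single p.1 1 := by
  ext q
  by_cases hq : q ∈ C
  · rw [extendVars_of_mem hq]
    by_cases hqp : q = p.1
    · subst hqp; simp
    · rw [Pi.single_eq_of_ne hqp, Pi.single_eq_of_ne]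
      exact fun h => hqp (congrArg Subtype.val h)
  · rw [extendVars_of_notMem hq, Pi.single_eq_of_ne]
    rintro rfl
    exact hq p.2

/-- If the variables of `C` span those outside of the blocks `T`, then `C` can correct every
deviation outside of `T`. -/
theorem apply_mem_range_of_span {X : Type*} [AddCommGroup X] [Module (ZMod 2) X]
    (L : Inputs M →ₗ[ZMod 2] X) {T : Finset (FreeBlock M)} {C : Finset (FreeVar M)}
    (hspan : ∀ p : FreeVar M, p.1 ∉ T → L (Pi.single p 1) ∈
      Submodule.span (ZMod 2) ((fun p => L (Pi.single p 1)) '' (C : Set (FreeVar M))))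
    (u : Inputs M) (hu : ∀ p : FreeVar M, p.1 ∈ T → u p = 0) :
    L u ∈ LinearMap.range (L ∘ₗ extendVars C) := by
  have hle : Submodule.span (ZMod 2) ((fun p => L (Pi.single p 1)) '' (C : Set (FreeVar M))) ≤
      LinearMap.range (L ∘ₗ extendVars C) := by
    rw [Submodule.span_le]
    rintro _ ⟨p, hp, rfl⟩
    exact ⟨Pi.single ⟨p, hp⟩ 1, by rw [LinearMap.comp_apply, extendVars_single]⟩
  rw [pi_eq_sum_univ' u, map_sum]
  refine Submodule.sum_mem _ fun p _ => ?_
  rw [map_smul]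
  by_cases hp : p.1 ∈ T
  · rw [hu p hp, zero_smul]
    exact Submodule.zero_mem _
  · refine Submodule.smul_mem _ _ (hle ?_)
    have := hspan p hp
    convert this using 2

/-- A cross-adjacent completion of an affine subspace on the blocks of `T`. -/
theorem IsRestriction.exists_point (h : IsRestriction G M W A b) (hG : ManyCommonNbrs G R)
    (T : Finset (FreeBlock M)) (hT : W.card + T.card ≤ R) :
    ∃ x, CrossAdjacent G (M ∪ T.image (selected (A x + b))) := by
  classical
  -- Blocks of `T` already committed by `W` keep their vertices; only the others are completed
  -- greedily.
  set J : Finset (Fin k) := (T.image Subtype.val).filter (· ∉ blocks W)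
  have hJcard : J.card ≤ T.card := (Finset.card_filter_le _ _).trans Finset.card_image_le
  obtain ⟨y, W₁, hWW₁, hcross, -, -, hy⟩ := hG.exists_pairs h.cross (fun _ => 0) 1
    card_addPair_zero_le J (fun i hi => (Finset.mem_filter.1 hi).2) (by omega)
  refine ⟨fun p => y p.1.1 p.2, hcross.mono (Finset.union_subset (h.subset.trans hWW₁) ?_)⟩
  intro v hv
  obtain ⟨i, hi, rfl⟩ := Finset.mem_image.1 hv
  by_cases hiW : i.1 ∈ blocks W
  · exact hWW₁ (h.sel _ i hiW)
  · have hiJ : i.1 ∈ J :=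
      Finset.mem_filter.2 ⟨Finset.mem_image_of_mem _ hi, hiW⟩
    have : selected (A (fun p => y p.1.1 p.2) + b) i = (i.1, y i.1) :=
      Prod.ext rfl (funext fun l => h.free _ (i, l) hiW)
    rw [this]
    exact (hy i.1 hiJ).1

/-- An affine subspace of codimension `c` that contains the image of some restriction contains the
image of a restriction with at most `2 c` new vertices. -/
theorem IsRestriction.exists_small (h : IsRestriction G M W A b) (hG : ManyCommonNbrs G R)
    {F : AffineSubspace (ZMod 2) (Inputs M)} (hF : ∀ x, A x + b ∈ F)
    (hW : W.card + codim F ≤ R) (hM : M.card + 2 * codim F ≤ R) :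
    ∃ (W' : Finset (Vertex k m)) (A' : Inputs M →ₗ[ZMod 2] Inputs M) (b' : Inputs M),
      IsRestriction G M W' A' b' ∧ W'.card ≤ M.card + 2 * codim F ∧ ∀ x, A' x + b' ∈ F := by
  classical
  set L := F.direction.mkQ
  obtain ⟨T, C, hinj, hCT, hspan, hcard⟩ :=
    exists_blocks_and_transversal (fun p : FreeVar M => L (Pi.single p 1))
  change T.card + C.card ≤ codim F at hcard
  obtain ⟨x₁, hcross⟩ := h.exists_point hG T (by omega)
  set x₀ := A x₁ + b
  have hx₀ : x₀ ∈ F := hF x₁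
  set WT := M ∪ T.image (selected x₀)
  have hWTcard : WT.card ≤ M.card + T.card :=
    (Finset.card_union_le _ _).trans (Nat.add_le_add_left Finset.card_image_le _)
  have hWTblocks : ∀ i : FreeBlock M, i.1 ∈ blocks WT ↔ i ∈ T := by
    intro i
    rw [mem_blocks]
    constructor
    · rintro ⟨v, hv, hvi⟩
      rcases Finset.mem_union.1 hv with hv | hv
      · exact absurd (hvi ▸ fst_mem_blocks hv) i.2
      · obtain ⟨j, hj, rfl⟩ := Finset.mem_image.1 hv
        have : j = i := Subtype.ext hvi
        exact this ▸ hj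
    · intro hi
      exact ⟨selected x₀ i, Finset.mem_union_right _ (Finset.mem_image_of_mem _ hi), rfl⟩
  let e : Fin k → Fin m → ZMod 2 := fun i =>
    if h : ∃ p ∈ C, p.1.1 = i then Pi.single h.choose.2 1 else 0
  have he : ∀ p ∈ C, e p.1.1 = Pi.single p.2 1 := by
    intro p hp
    have hex : ∃ q ∈ C, q.1.1 = p.1.1 := ⟨p, hp, rfl⟩
    have heq : hex.choose = p :=
      hinj hex.choose_spec.1 hp (Subtype.ext hex.choose_spec.2)
    simp only [e, dif_pos hex, heq]
  set J : Finset (Fin k) := C.image fun p => p.1.1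
  have hJcard : J.card ≤ C.card := Finset.card_image_le
  obtain ⟨y, W', hWW', hcross', hblocks, hcard', hy⟩ := hG.exists_pairs hcross e 2
    (fun W i y => card_addPair_le W i y (e i)) J (by
      intro i hi
      obtain ⟨p, hp, rfl⟩ := Finset.mem_image.1 hi
      rw [hWTblocks]
      exact hCT p hp) (by omega)
  have hW'blocks : ∀ i : FreeBlock M, i.1 ∈ blocks W' ↔ i ∈ T ∨ ∃ p ∈ C, p.1 = i := by
    intro i
    rw [hblocks, Finset.mem_union, hWTblocks, Finset.mem_image]
    simp only [Subtype.ext_iff]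
  -- A linear choice of values for `C` correcting a given deviation modulo the direction of `F`;
  -- linearity keeps the restriction affine.
  obtain ⟨s, hs⟩ := exists_section_on_range (L ∘ₗ extendVars C)
  let base : Inputs M →ₗ[ZMod 2] Inputs M :=
    LinearMap.pi fun p => if p.1.1 ∈ blocks W' then 0 else LinearMap.proj p
  have hbase : ∀ x p, base x p = if p.1.1 ∈ blocks W' then 0 else x p := by
    intro x p
    by_cases hp : p.1.1 ∈ blocks W' <;> simp [base, hp]
  let b₀ : Inputs M := fun p =>
    if p.1 ∈ T then x₀ p else if p.1.1 ∈ blocks W' then y p.1.1 p.2 else 0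
  let A' : Inputs M →ₗ[ZMod 2] Inputs M := base - extendVars C ∘ₗ s ∘ₗ L ∘ₗ base
  let b' : Inputs M := b₀ + extendVars C (s (L (x₀ - b₀)))
  have hval : ∀ x, A' x + b' =
      base x + b₀ + extendVars C (s (L (x₀ - (base x + b₀)))) := by
    intro x
    simp only [A', b', LinearMap.sub_apply, LinearMap.comp_apply, map_sub, map_add]
    abel
  refine ⟨W', A', b', ⟨Finset.subset_union_left.trans hWW', hcross', ?_, ?_, ?_⟩, by omega, ?_⟩
  · intro x p hp
    have hp' := hp
    rw [hW'blocks, not_or] at hp'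
    have hpC : p ∉ C := fun hpC => hp'.2 ⟨p, hpC, rfl⟩
    rw [hval, Pi.add_apply, Pi.add_apply, extendVars_of_notMem hpC, hbase, if_neg hp]
    simp [b₀, hp, hp'.1]
  · intro x i hi
    by_cases hiT : i ∈ T
    · have : selected (A' x + b') i = selected x₀ i := by
        refine Prod.ext rfl (funext fun l => ?_)
        change (A' x + b') (i, l) = x₀ (i, l)
        have hC : (i, l) ∉ C := fun hC => hCT _ hC hiT
        rw [hval, Pi.add_apply, Pi.add_apply, extendVars_of_notMem hC, hbase, if_pos hi]
        simp [b₀, hiT]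
      rw [this]
      exact hWW' (Finset.mem_union_right _ (Finset.mem_image_of_mem _ hiT))
    · obtain ⟨p, hp, rfl⟩ := ((hW'blocks i).1 hi).resolve_left hiT
      obtain ⟨hy1, hy2⟩ := hy p.1.1 (Finset.mem_image_of_mem _ hp)
      rw [he p hp] at hy2
      set r := s (L (x₀ - (base x + b₀)))
      have : selected (A' x + b') p.1 = (p.1.1, y p.1.1 + r ⟨p, hp⟩ • Pi.single p.2 1) := by
        refine Prod.ext rfl (funext fun l => ?_)
        change (A' x + b') (p.1, l) = _
        rw [hval, Pi.add_apply, Pi.add_apply, hbase, if_pos hi]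
        by_cases hl : l = p.2
        · subst hl
          rw [extendVars_of_mem (p := (p.1, p.2)) hp]
          simp [b₀, hiT, hi, r]
        · have hC : (p.1, l) ∉ C := fun hC => hl (congrArg Prod.snd (hinj hC hp rfl))
          rw [extendVars_of_notMem hC]
          simp [b₀, hiT, hi, hl]
      rw [this]
      rcases (by decide : ∀ t : ZMod 2, t = 0 ∨ t = 1) (r ⟨p, hp⟩) with ht | ht
      · rw [ht, zero_smul, add_zero]
        exact hy1
      · rw [ht, one_smul]
        exact hy2
  · intro x hx
    have : base x = 0 := by
      ext p
      rw [hbase]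
      split_ifs with hp
      · rfl
      · exact hx p hp
    simp only [A', LinearMap.sub_apply, LinearMap.comp_apply, this, map_zero, sub_zero]
  · intro x
    refine mem_of_mkQ_eq hx₀ ?_
    -- The deviation from `x₀` vanishes on `T`, so the span property of `C` makes it correctable.
    have hr := hs (L (x₀ - (base x + b₀))) (apply_mem_range_of_span L hspan _ (by
      intro p hp
      have hpW : p.1.1 ∈ blocks W' := (hW'blocks p.1).2 (Or.inl hp)
      simp [hbase, hpW, b₀, hp]))
    rw [LinearMap.comp_apply] at hr
    change L (A' x + b') = L x₀
    rw [hval, map_add, hr, ← map_add, add_sub_cancel]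

/-- The constant 3 comes from `(4/3)^3 = 64/27 > 2`. -/
theorem natCast_le_three_mul_logb {c : ℕ} {S : ℝ} (h : (4 / 3 : ℝ) ^ c ≤ S) :
    (c : ℝ) ≤ 3 * Real.logb 2 S := by
  have hS : 0 < S := lt_of_lt_of_le (by positivity) h
  have h1 : (2 : ℝ) ^ c ≤ S ^ 3 :=
    calc (2 : ℝ) ^ c ≤ ((4 / 3) ^ 3) ^ c := pow_le_pow_left₀ (by norm_num) (by norm_num) c
      _ = ((4 / 3) ^ c) ^ 3 := by rw [← pow_mul, ← pow_mul, mul_comm]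
      _ ≤ S ^ 3 := pow_le_pow_left₀ (by positivity) h 3
  have h2 := Real.logb_le_logb_of_le (b := 2) (by norm_num) (by positivity) h1
  rw [Real.logb_pow, Real.logb_pow, Real.logb_self_eq_one (by norm_num), mul_one] at h2
  exact_mod_cast h2

end Final

end BinClique

theorem mainTheorem7 :
    ∃ C : ℝ, 0 < C ∧
      ∀ (k m R : ℕ) (α β : ℝ) (G : SimpleGraph (BinClique.Vertex k m)),
        0 < α → α ≤ 1 → 0 < β → β < 1 / 300 → 0 < R → 100 * (1 - α) * (R : ℝ) ≤ 1 →
        BinClique.HasBoundedCommonNbhds G α β R →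
        ∀ (M : Finset (BinClique.Vertex k m)), BinClique.CrossAdjacent G M →
        ∀ (D S : ℕ) (A : BinClique.AffineDAG (BinClique.FreeVar M)),
          BinClique.SolvesNonEdge G M A → A.DepthAtMost D → A.size ≤ S →
          ((R : ℝ) - (M.card : ℝ)) / 8 < (D : ℝ) ∧
          ∀ d : ℕ, d = ⌊√(Real.logb 2 S) * min (√(R : ℝ)) (1 / β)⌋₊ → M.card + 8 * d ≤ R →
            ∃ M' : Finset (BinClique.Vertex k m), M ⊆ M' ∧ BinClique.CrossAdjacent G M' ∧
              (M'.card : ℝ) ≤ (M.card : ℝ) + C * Real.logb 2 S ∧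
              ∃ A' : BinClique.AffineDAG (BinClique.FreeVar M'),
                BinClique.SolvesNonEdge G M' A' ∧ d ≤ D ∧ A'.DepthAtMost (D - d) ∧
                  A'.size ≤ S := by
  -- `6 = 2 · 3`: two vertices per unit of codimension, and codimension at most `3 log₂ S`.
  refine ⟨6, by norm_num, ?_⟩
  intro k m R α β G hα0 hα1 _ hβ hR0 hR hG M hM D S A hA hD hS
  have hmany := BinClique.manyCommonNbrs hα0 hα1 hβ hR hG
  have hlt := BinClique.lt_depth hmany hR0 hM hA hD
  refine ⟨?_, fun d _ hd => ?_⟩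
  · have : (R : ℝ) < M.card + 8 * D := by exact_mod_cast hlt
    linarith
  · obtain ⟨v, W, L, b, hpath, hcod, hsize, h, hW, hv⟩ :=
      BinClique.exists_popular_node hmany hR0 hM hA (t := d) (by omega)
    obtain ⟨M', L', b', h', hM', hv'⟩ := h.exists_small hmany hv (by omega) (by omega)
    refine ⟨M', h'.subset, h'.cross, ?_, A.restrict v (L' ∘ₗ BinClique.extendZero M M') b'
      (fun x => hv' _), h'.solvesNonEdge_restrict hA _, by omega, hD.restrict _ hpath,
      (A.size_restrict_le v _ b' _).trans hS⟩
    have h1 := BinClique.natCast_le_three_mul_logb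
      (hsize.trans (by exact_mod_cast hS : (A.size : ℝ) ≤ S))
    have h2 : (M'.card : ℝ) ≤ M.card + 2 * BinClique.codim (A.label v) := by exact_mod_cast hM'
    linarith
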